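/- Let $\mathcal G$ be a closed graph, i.e. the geometric realization of a finite undirected graph $G=(V,E)$ without boundary (multiple edges and self-loops allowed), where every edge $e$ has a length $\ell_e>0$ and a weight $a_e>0$ and every vertex $v$ has a mass $\mathcal V(v)>0$. Each edge $e$ is an interval of length $\ell_e$ in $\mathcal G$; put $\mathcal E(e)=a_e\ell_e$, and $\mathcal V(\Omega)=\sum_{v\in V\cap\Omega}\mathcal V(v)$ for $\Omega\subset\mathcal G$. Let $\rho_{\sup}=\max_{v}\rho(v)$ with $\rho(v)=\mathcal V(v)^{-1}\sum_{e\ni v}\mathcal E(e)/2$ (every edge $e$ having $v$ as an endpoint is counted once). For an open $\Omega\subset\mathcal G$ with finite topological boundary $\partial\Omega$, let $\mathcal A(\partial\Omega)$ be the sum of $a_e$ over the points of $\partial\Omega$ interior to an edge $e$, plus, for every vertex $v\in\partial\Omega$, the sum of $a_e$ over those edges $e$ such that $v$ lies in the closure of the intersection of $\Omega$ with the interior of $e$. For $2<\nu\le\infty$ put $$\widetilde I_\nu=\inf_\Omega\ \mathcal A(\partial\Omega)\,\min\bigl(\mathcal V(\Omega),\mathcal V(\mathcal G\setminus\Omega)\bigr)^{(1/\nu)-1},$$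 the infimum being over the open $\Omega$ with finite boundary and $\mathcal V(\Omega)>0$, $\mathcal V(\mathcal G\setminus\Omega)>0$. Let $0=\lambda_0\le\lambda_1\le\dots\le\lambda_{|V|-1}$ be the eigenvalues, with multiplicity, of the Laplacian $$(\Delta f)(v)=\mathcal V(v)^{-1}\sum_{e\sim\{u,v\}}a_e\,\frac{f(v)-f(u)}{\ell_e}$$ on edgewise linear functions (equivalently, on functions $V\to\mathbb R$). Then for every $\nu$ with $2<\nu\le\infty$ and every integer $k$ with $1\le k\le|V|-1$, $$\lambda_k\ \ge\ \Bigl(\frac{k}{\mathcal V(\mathcal G)}\Bigr)^{2/\nu}\,2^{-4/\nu}\,\frac{\bigl(\widetilde I_\nu\,\rho_{\sup}^{-1/2}/2\bigr)^2}{e}$$ (with $2/\nu=4/\nu=1/\nu=0$ if $\nu=\infty$; the right-hand side is read as $0$ if $\widetilde I_\nu=0$). If moreover $\nu<\infty$ and $\widetilde I_\nu>0$, the right-hand side equals $(k/\mathcal V(\mathcal G))^{2/\nu}\,C_2^{-2/\nu}\,\nu/(2e)$, where $C_1=2^{-2/\nu}\,\widetilde I_\nu\rho_{\sup}^{-1/2}/2$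 and $C_2=(\nu/2)^{\nu/2}C_1^{-\nu}$. -/

import Mathlib

open scoped ENNReal

/-- A closed graph, i.e. a finite graph without boundary (finiteness of the vertex set `V` and of
the edge set `E` is imposed by `Fintype` instances).  Multiple edges and self-loops are allowed.
Every edge has a length and an edge weight, every vertex a mass.  Graphs are undirected:
the order of the two endpoints `src e`, `tgt e` of `e` only serves to parametrize the edge. -/
structure ClosedGraph (V E : Type*) where
  src : E → V
  tgt : E → V
  /-- the length `ℓ_e` -/
  len : E → ℝ
  len_pos : ∀ e, 0 < len e
  /-- the density `a_e` of the edge measure on `e` with respect to Lebesgue measure -/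
  wt : E → ℝ
  wt_pos : ∀ e, 0 < wt e
  /-- the vertex measure of a vertex -/
  vol : V → ℝ
  vol_pos : ∀ v, 0 < vol v

namespace ClosedGraph

noncomputable section

variable {V E : Type*} (G : ClosedGraph V E)

/-- The disjoint union of the vertices and of the intervals `[0, ℓ_e]`. -/
abbrev Pieces : Type _ := V ⊕ (Σ e : E, Set.Icc (0 : ℝ) (G.len e))

/-- The two ends of the interval of `e` are glued to the endpoints of `e`. -/
inductive Glue : G.Pieces → G.Pieces → Prop
  | src (e : E) :
      Glue (Sum.inr ⟨e, ⟨0, Set.left_mem_Icc.2 (G.len_pos e).le⟩⟩) (Sum.inl (G.src e))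
  | tgt (e : E) :
      Glue (Sum.inr ⟨e, ⟨G.len e, Set.right_mem_Icc.2 (G.len_pos e).le⟩⟩) (Sum.inl (G.tgt e))

/-- The vertex set is given the discrete topology. -/
@[reducible] def piecesTopology : TopologicalSpace G.Pieces :=
  @instTopologicalSpaceSum V (Σ e : E, Set.Icc (0 : ℝ) (G.len e)) ⊥ inferInstance

/-- The geometric realization, with the quotient topology. -/
def Realization : Type _ := Quot G.Glue

instance : TopologicalSpace G.Realization :=
  @instTopologicalSpaceQuot G.Pieces G.Glue G.piecesTopology

/-- A vertex as a point of the geometric realization. -/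
def vertexPoint (v : V) : G.Realization := Quot.mk _ (Sum.inl v)

/-- The point of the edge `e` at distance `t` from its first endpoint. -/
def edgePoint (e : E) (t : Set.Icc (0 : ℝ) (G.len e)) : G.Realization :=
  Quot.mk _ (Sum.inr ⟨e, t⟩)

/-- The interior of the edge `e` in the geometric realization. -/
def edgeInterior (e : E) : Set G.Realization :=
  {x | ∃ t : Set.Icc (0 : ℝ) (G.len e), 0 < (t : ℝ) ∧ (t : ℝ) < G.len e ∧ x = G.edgePoint e t}

/-- The vertex measure `𝒱(Ω)` of a subset of the geometric realization. -/
def volume [Fintype V] (Ω : Set G.Realization) : ℝ :=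
  ∑ v, {v | G.vertexPoint v ∈ Ω}.indicator G.vol v

open Classical in
/-- The area `𝒜(∂Ω)` of the boundary of an open set: every boundary point inside an edge `e`
contributes `a_e`, every vertex `v` on the boundary contributes `a_e` for every edge `e` such that
`v` lies in the closure of the part of `Ω` inside `e`. -/
def boundaryArea [Fintype V] [Fintype E] (Ω : Set G.Realization) : ℝ :=
  ∑ e, G.wt e * ((frontier Ω ∩ G.edgeInterior e).ncard : ℝ) +
    ∑ v, ∑ e, if G.vertexPoint v ∈ frontier Ω ∧
      G.vertexPoint v ∈ closure (Ω ∩ G.edgeInterior e) then G.wt e else 0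

/-- Admissible sets: open with finite topological boundary. -/
def Admissible (Ω : Set G.Realization) : Prop := IsOpen Ω ∧ (frontier Ω).Finite

/-- `𝒜(∂Ω) · min(𝒱(Ω), 𝒱(Ωᶜ)) ^ (1/ν - 1)`, used where `𝒱(Ω)` and `𝒱(Ωᶜ)` are positive. -/
def isoRatio [Fintype V] [Fintype E] (ν : ℝ≥0∞) (Ω : Set G.Realization) : ℝ :=
  G.boundaryArea Ω * (min (G.volume Ω) (G.volume Ωᶜ)) ^ ((1 / ν).toReal - 1)

/-- The isoperimetric constant `Ĩ_ν`.  Sets with `𝒱(Ω) = 0` or `𝒱(Ωᶜ) = 0`, whose ratio is `+∞`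
by convention, are left out of the infimum. -/
def isoConst [Fintype V] [Fintype E] (ν : ℝ≥0∞) : ℝ :=
  sInf {r | ∃ Ω : Set G.Realization,
    G.Admissible Ω ∧ 0 < G.volume Ω ∧ 0 < G.volume Ωᶜ ∧ r = G.isoRatio ν Ω}

open Classical in
/-- The half-degree `ρ(v) = 𝒱(v)⁻¹ ∑_{e ∋ v} ℰ(e) / 2`, where `ℰ(e) = a_e ℓ_e`. -/
def halfDegree [Fintype E] (v : V) : ℝ :=
  (G.vol v)⁻¹ * ∑ e, if G.src e = v ∨ G.tgt e = v then G.wt e * G.len e / 2 else 0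

/-- `ρ_sup` -/
def rhoSup [Fintype E] : ℝ := ⨆ v, G.halfDegree v

open Classical in
/-- The (positive semidefinite) Laplacian on edgewise linear functions, which are identified with
their values at the vertices:
`(Δ f)(v) = 𝒱(v)⁻¹ ∑_{e ∼ {u, v}} a_e (f(v) - f(u)) / ℓ_e`. -/
def laplacian [Fintype E] : (V → ℝ) →ₗ[ℝ] (V → ℝ) where
  toFun f v := (G.vol v)⁻¹ * ∑ e, G.wt e / G.len e *
    ((if G.src e = v then f v - f (G.tgt e) else 0) +
      (if G.tgt e = v then f v - f (G.src e) else 0))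
  map_add' f g := by
    funext v
    simp only [Pi.add_apply]
    rw [← mul_add, ← Finset.sum_add_distrib]
    refine congrArg _ (Finset.sum_congr rfl fun e _ => ?_)
    split_ifs <;> ring
  map_smul' c f := by
    funext v
    simp only [Pi.smul_apply, smul_eq_mul, RingHom.id_apply]
    rw [mul_left_comm]
    refine congrArg _ ?_
    rw [Finset.mul_sum]
    refine Finset.sum_congr rfl fun e _ => ?_
    split_ifs <;> ring

/-- The eigenvalues `λ_0 ≤ λ_1 ≤ λ_2 ≤ …` of the Laplacian, repeated according to multiplicity,
numbered from `0` (so that `λ_0 = 0`). -/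
def eigenvalue [Fintype V] [Fintype E] (k : ℕ) : ℝ :=
  (G.laplacian.charpoly.roots.sort (· ≤ ·)).getD k 0

/-- `C₁ = 2 ^ (-2/ν) · (Ĩ_ν ρ_sup ^ (-1/2) / 2)` -/
def nashC₁ [Fintype V] [Fintype E] (ν : ℝ≥0∞) : ℝ :=
  (2 : ℝ) ^ (-(2 / ν).toReal) * (G.isoConst ν * G.rhoSup ^ (-(1 / 2) : ℝ) / 2)

/-- `C₂ = (ν/2) ^ (ν/2) · C₁ ^ (-ν)`, for finite `ν` -/
def nashC₂ [Fintype V] [Fintype E] (ν : ℝ≥0∞) : ℝ :=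
  (ν.toReal / 2) ^ (ν.toReal / 2) * G.nashC₁ ν ^ (-ν.toReal)

end

end ClosedGraph

/-! The route is isoperimetry, Sobolev, Nash, heat kernel decay, trace. Write α = 1/ν, I for
`isoConst`, J for `cheegerConst`, D for the Dirichlet form and W for the total mass.

Cutting edges at their midpoints turns a vertex set S into an admissible open set, so I ·
mass(S)^(1-α) ≤ TV(1_S) when S has at most half the mass (`isoConst_mul_le_totalVariation`). Peeling
off horizontal layers upgrades this to a Sobolev inequality for nonnegative functions supported on
at most half the mass (`isoConst_mul_sobolevNorm_le`). Apply it to the squares of the positive and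
negative parts of f minus a median. Cauchy–Schwarz over the edges and Hölder then give
`nash_inequality`: J² ‖f‖₂^(2+4α) ≤ D(f) ‖f‖₁^(4α) for f of mean zero.

The heat kernel minus 1/W has mean zero and ℓ¹ norm at most 2, so its squared ℓ² norm u satisfies u'
≤ -2C u^(1+2α) with C = J² 2^(-4α), whence u(t) ≤ (4αCt)^(-1/(2α)). Integrating u over the base
point gives ∑ exp(-2tλ_i) - 1 ≥ k exp(-2tλ_k), and the best t costs the factor 1/e
(`rpow_mul_le_eigenvalue`). For ν = ∞ the Nash inequality is a Poincaré inequality, and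
`cheeger_inequality` gives λ_k ≥ J² directly. -/

namespace ClosedGraph

noncomputable section

variable {V E : Type*} (G : ClosedGraph V E)

/-! ### Isoperimetry for vertex sets -/

/-- The total variation of a function on the vertices. -/
def totalVariation [Fintype E] (f : V → ℝ) : ℝ :=
  ∑ e, G.wt e * |f (G.src e) - f (G.tgt e)|

/-- The total mass of a set of vertices. -/
def mass [Fintype V] (S : Set V) : ℝ := ∑ v, S.indicator G.vol v

/-- The edgewise linear extension of a function on the vertices to the geometric realization. -/
def linearExtension (f : V → ℝ) : G.Realization → ℝ :=
  Quot.lift (Sum.elim f fun p =>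
    f (G.src p.1) + (f (G.tgt p.1) - f (G.src p.1)) * ((p.2 : ℝ) / G.len p.1)) (by
    rintro _ _ (e | e)
    · simp
    · simp [div_self (G.len_pos e).ne'])

@[simp]
theorem linearExtension_vertexPoint (f : V → ℝ) (v : V) :
    G.linearExtension f (G.vertexPoint v) = f v := rfl

theorem linearExtension_edgePoint (f : V → ℝ) (e : E) (t : Set.Icc (0 : ℝ) (G.len e)) :
    G.linearExtension f (G.edgePoint e t) =
      f (G.src e) + (f (G.tgt e) - f (G.src e)) * ((t : ℝ) / G.len e) := rfl

theorem continuous_linearExtension (f : V → ℝ) : Continuous (G.linearExtension f) := by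
  let _ : TopologicalSpace V := ⊥
  have _ : DiscreteTopology V := ⟨rfl⟩
  refine continuous_quot_lift _ (Continuous.sumElim continuous_of_discreteTopology ?_)
  refine continuous_sigma fun e => ?_
  dsimp only
  fun_prop

theorem exists_edgePoint_or_vertexPoint (x : G.Realization) :
    (∃ v, x = G.vertexPoint v) ∨ ∃ e, x ∈ G.edgeInterior e := by
  obtain ⟨p, rfl⟩ := Quot.exists_rep x
  rcases p with v | ⟨e, t⟩
  · exact Or.inl ⟨v, rfl⟩
  rcases t.2.1.eq_or_lt with h0 | h0
  · obtain ⟨t, ht⟩ := t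
    obtain rfl : 0 = t := h0
    exact Or.inl ⟨G.src e, Quot.sound (Glue.src e)⟩
  rcases t.2.2.eq_or_lt with h1 | h1
  · obtain ⟨t, ht⟩ := t
    obtain rfl : t = G.len e := h1
    exact Or.inl ⟨G.tgt e, Quot.sound (Glue.tgt e)⟩
  exact Or.inr ⟨e, t, h0, h1, rfl⟩

/-- The midpoint of an edge. -/
def midpoint (e : E) : G.Realization :=
  G.edgePoint e ⟨G.len e / 2, by have := G.len_pos e; constructor <;> linarith⟩

/-- The neighbourhood of a set of vertices that extends halfway along the edges. -/
def halfNeighborhood (S : Set V) : Set G.Realization :=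
  {x | 1 / 2 < G.linearExtension (S.indicator 1) x}

theorem isOpen_halfNeighborhood (S : Set V) : IsOpen (G.halfNeighborhood S) :=
  isOpen_lt continuous_const (G.continuous_linearExtension _)

theorem vertexPoint_mem_halfNeighborhood (S : Set V) (v : V) :
    G.vertexPoint v ∈ G.halfNeighborhood S ↔ v ∈ S := by
  by_cases h : v ∈ S <;> norm_num [halfNeighborhood, h]

theorem linearExtension_of_mem_frontier {S : Set V} {x : G.Realization}
    (hx : x ∈ frontier (G.halfNeighborhood S)) :
    G.linearExtension (S.indicator 1) x = 1 / 2 :=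
  (frontier_lt_subset_eq continuous_const (G.continuous_linearExtension _) hx).symm

/-- The extension takes only the values 0 and 1 at vertices, never 1/2. Hence the vertex term of
`boundaryArea` drops out. -/
theorem vertexPoint_notMem_frontier (S : Set V) (v : V) :
    G.vertexPoint v ∉ frontier (G.halfNeighborhood S) := by
  intro h
  have := G.linearExtension_of_mem_frontier h
  by_cases hv : v ∈ S <;> simp [hv] at this

theorem frontier_inter_edgeInterior_subset (S : Set V) (e : E) :
    frontier (G.halfNeighborhood S) ∩ G.edgeInterior e ⊆ {G.midpoint e} := by
  rintro _ ⟨hx, t, h0, h1, rfl⟩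
  have h := G.linearExtension_of_mem_frontier hx
  rw [linearExtension_edgePoint] at h
  have hl := G.len_pos e
  have ht : (t : ℝ) = G.len e / 2 := by
    by_cases hs : G.src e ∈ S <;> by_cases ht : G.tgt e ∈ S <;>
      simp [hs, ht] at h <;> field_simp at h <;> linarith
  rw [Set.mem_singleton_iff, midpoint]
  congr 1
  exact Subtype.ext ht

/-- On an edge with both ends on the same side of `S` the extension is constantly 0 or 1; on a cut
edge only the midpoint can lie on the frontier. -/
theorem ncard_frontier_inter_edgeInterior_le (S : Set V) (e : E) :
    ((frontier (G.halfNeighborhood S) ∩ G.edgeInterior e).ncard : ℝ) ≤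
      |S.indicator (1 : V → ℝ) (G.src e) - S.indicator 1 (G.tgt e)| := by
  have hle : (frontier (G.halfNeighborhood S) ∩ G.edgeInterior e).ncard ≤ 1 := by
    refine (Set.ncard_le_ncard (G.frontier_inter_edgeInterior_subset S e)).trans ?_
    simp
  by_cases h : S.indicator (1 : V → ℝ) (G.src e) = S.indicator 1 (G.tgt e)
  · have hempty : frontier (G.halfNeighborhood S) ∩ G.edgeInterior e = ∅ := by
      refine Set.eq_empty_of_forall_notMem ?_
      rintro _ ⟨hx, t, h0, h1, rfl⟩
      have h' := G.linearExtension_of_mem_frontier hx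
      rw [linearExtension_edgePoint, ← h, sub_self, zero_mul, add_zero] at h'
      by_cases hs : G.src e ∈ S <;> simp [hs] at h'
    simp [hempty]
  · have h1 : |S.indicator (1 : V → ℝ) (G.src e) - S.indicator 1 (G.tgt e)| = 1 := by
      by_cases hs : G.src e ∈ S <;> by_cases ht : G.tgt e ∈ S <;> simp [hs, ht] at h ⊢
    rw [h1]
    exact_mod_cast hle

theorem finite_frontier_halfNeighborhood [Finite E] (S : Set V) :
    (frontier (G.halfNeighborhood S)).Finite := by
  refine (Set.finite_range G.midpoint).subset fun x hx => ?_
  rcases G.exists_edgePoint_or_vertexPoint x with ⟨v, rfl⟩ | ⟨e, he⟩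
  · exact absurd hx (G.vertexPoint_notMem_frontier S v)
  · exact ⟨e, (G.frontier_inter_edgeInterior_subset S e ⟨hx, he⟩).symm⟩


theorem boundaryArea_halfNeighborhood_le [Fintype V] [Fintype E] (S : Set V) :
    G.boundaryArea (G.halfNeighborhood S) ≤ G.totalVariation (S.indicator 1) := by
  unfold boundaryArea totalVariation
  simp only [G.vertexPoint_notMem_frontier, false_and, if_false, Finset.sum_const_zero, add_zero]
  exact Finset.sum_le_sum fun e _ =>
    mul_le_mul_of_nonneg_left (G.ncard_frontier_inter_edgeInterior_le S e) (G.wt_pos e).le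

theorem volume_halfNeighborhood [Fintype V] (S : Set V) : G.volume (G.halfNeighborhood S) = G.mass S := by
  simp [volume, mass, vertexPoint_mem_halfNeighborhood]

theorem volume_compl_halfNeighborhood [Fintype V] (S : Set V) :
    G.volume (G.halfNeighborhood S)ᶜ = G.mass Sᶜ := by
  simp only [volume, mass, Set.mem_compl_iff, vertexPoint_mem_halfNeighborhood]
  rfl

theorem mass_nonneg [Fintype V] (S : Set V) : 0 ≤ G.mass S :=
  Finset.sum_nonneg fun v _ => Set.indicator_nonneg (fun v _ => (G.vol_pos v).le) v

theorem mass_pos [Fintype V] {S : Set V} (hS : S.Nonempty) : 0 < G.mass S := by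
  obtain ⟨v, hv⟩ := hS
  refine Finset.sum_pos' (fun v _ => Set.indicator_nonneg (fun v _ => (G.vol_pos v).le) v)
    ⟨v, Finset.mem_univ v, ?_⟩
  simpa [hv] using G.vol_pos v

theorem mass_empty [Fintype V] : G.mass ∅ = 0 := by simp [mass]

theorem mass_mono [Fintype V] {S T : Set V} (h : S ⊆ T) : G.mass S ≤ G.mass T :=
  Finset.sum_le_sum fun v _ =>
    Set.indicator_le_indicator_of_subset h (fun v => (G.vol_pos v).le) v

theorem volume_univ [Fintype V] : G.volume Set.univ = ∑ v, G.vol v := by simp [volume]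

theorem totalVariation_nonneg [Fintype E] (f : V → ℝ) : 0 ≤ G.totalVariation f :=
  Finset.sum_nonneg fun e _ => mul_nonneg (G.wt_pos e).le (abs_nonneg _)

theorem boundaryArea_nonneg [Fintype V] [Fintype E] (Ω : Set G.Realization) : 0 ≤ G.boundaryArea Ω := by
  unfold boundaryArea
  refine add_nonneg (Finset.sum_nonneg fun e _ => mul_nonneg (G.wt_pos e).le (Nat.cast_nonneg _))
    (Finset.sum_nonneg fun v _ => Finset.sum_nonneg fun e _ => ?_)
  split_ifs
  exacts [(G.wt_pos e).le, le_rfl]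

theorem volume_nonneg [Fintype V] (Ω : Set G.Realization) : 0 ≤ G.volume Ω :=
  Finset.sum_nonneg fun v _ => Set.indicator_nonneg (fun v _ => (G.vol_pos v).le) v

theorem isoRatio_nonneg [Fintype V] [Fintype E] (ν : ℝ≥0∞) (Ω : Set G.Realization) : 0 ≤ G.isoRatio ν Ω :=
  mul_nonneg (G.boundaryArea_nonneg Ω)
    (Real.rpow_nonneg (le_min (G.volume_nonneg _) (G.volume_nonneg _)) _)

theorem isoConst_nonneg [Fintype V] [Fintype E] (ν : ℝ≥0∞) : 0 ≤ G.isoConst ν := by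
  refine Real.sInf_nonneg ?_
  rintro _ ⟨Ω, -, -, -, rfl⟩
  exact G.isoRatio_nonneg ν Ω

/-- The isoperimetric inequality for sets of vertices. -/
theorem isoConst_mul_le_totalVariation [Fintype V] [Fintype E] (ν : ℝ≥0∞) {S : Set V} (hS : S.Nonempty)
    (hle : G.mass S ≤ G.mass Sᶜ) :
    G.isoConst ν * G.mass S ^ (1 - (1 / ν).toReal) ≤ G.totalVariation (S.indicator 1) := by
  have hpos := G.mass_pos hS
  have hI : G.isoConst ν ≤ G.isoRatio ν (G.halfNeighborhood S) := by
    refine csInf_le ⟨0, ?_⟩ ⟨_, ⟨G.isOpen_halfNeighborhood S,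
      G.finite_frontier_halfNeighborhood S⟩, ?_, ?_, rfl⟩
    · rintro _ ⟨Ω, -, -, -, rfl⟩
      exact G.isoRatio_nonneg ν Ω
    · rwa [volume_halfNeighborhood]
    · rw [volume_compl_halfNeighborhood]
      exact hpos.trans_le hle
  rw [isoRatio, volume_halfNeighborhood, volume_compl_halfNeighborhood, min_eq_left hle] at hI
  have hp := Real.rpow_pos_of_pos hpos (1 - (1 / ν).toReal)
  calc G.isoConst ν * G.mass S ^ (1 - (1 / ν).toReal)
      ≤ G.boundaryArea (G.halfNeighborhood S) * G.mass S ^ ((1 / ν).toReal - 1) *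
          G.mass S ^ (1 - (1 / ν).toReal) := mul_le_mul_of_nonneg_right hI hp.le
    _ = G.boundaryArea (G.halfNeighborhood S) := by
        rw [mul_assoc, ← Real.rpow_add hpos]
        simp
    _ ≤ _ := G.boundaryArea_halfNeighborhood_le S

/-! ### Sobolev inequality by peeling layers -/

/-- The weighted `ℓ^(1/(1-α))` norm of a nonnegative function on the vertices. -/
def sobolevNorm [Fintype V] (α : ℝ) (h : V → ℝ) : ℝ :=
  (∑ v, G.vol v * h v ^ (1 / (1 - α))) ^ (1 - α)

theorem sobolevNorm_nonneg [Fintype V] (α : ℝ) {h : V → ℝ} (h0 : 0 ≤ h) :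
    0 ≤ G.sobolevNorm α h :=
  Real.rpow_nonneg (Finset.sum_nonneg fun v _ =>
    mul_nonneg (G.vol_pos v).le (Real.rpow_nonneg (h0 v) _)) _

/-- Minkowski's inequality, with the weight absorbed into the function as `vol ^ (1 - α)`. -/
theorem sobolevNorm_add_le [Fintype V] {α : ℝ} (hα : 0 ≤ α) (hα1 : α < 1) {f g : V → ℝ}
    (hf : 0 ≤ f) (hg : 0 ≤ g) :
    G.sobolevNorm α (f + g) ≤ G.sobolevNorm α f + G.sobolevNorm α g := by
  have h1 : 0 < 1 - α := by linarith
  have hq : 1 ≤ 1 / (1 - α) := by rw [le_div_iff₀ h1]; linarith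
  have key : ∀ {x : V → ℝ}, 0 ≤ x → G.sobolevNorm α x =
      (∑ v, (G.vol v ^ (1 - α) * x v) ^ (1 / (1 - α))) ^ (1 / (1 / (1 - α))) := by
    intro x hx
    rw [sobolevNorm, one_div_one_div]
    congr 1
    refine Finset.sum_congr rfl fun v _ => ?_
    rw [Real.mul_rpow (Real.rpow_nonneg (G.vol_pos v).le _) (hx v),
      ← Real.rpow_mul (G.vol_pos v).le, mul_one_div_cancel h1.ne', Real.rpow_one]
  rw [key (add_nonneg hf hg), key hf, key hg]
  simp only [Pi.add_apply, mul_add]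
  exact Real.Lp_add_le_of_nonneg _ hq
    (fun v _ => mul_nonneg (Real.rpow_nonneg (G.vol_pos v).le _) (hf v))
    (fun v _ => mul_nonneg (Real.rpow_nonneg (G.vol_pos v).le _) (hg v))

theorem sobolevNorm_indicator [Fintype V] {α : ℝ} (hα1 : α < 1) {c : ℝ} (hc : 0 ≤ c)
    (S : Set V) :
    G.sobolevNorm α (fun v => c * S.indicator 1 v) = c * G.mass S ^ (1 - α) := by
  have h1 : 0 < 1 - α := by linarith
  have hsum : ∑ v, G.vol v * (c * S.indicator 1 v) ^ (1 / (1 - α)) =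
      c ^ (1 / (1 - α)) * G.mass S := by
    rw [mass, Finset.mul_sum]
    refine Finset.sum_congr rfl fun v _ => ?_
    by_cases hv : v ∈ S
    · simp [hv, mul_comm]
    · simp [hv, Real.zero_rpow (inv_ne_zero h1.ne')]
  rw [sobolevNorm, hsum, Real.mul_rpow (Real.rpow_nonneg hc _) (G.mass_nonneg S),
    ← Real.rpow_mul hc, one_div_mul_cancel h1.ne', Real.rpow_one]

/-- The layer and the remainder jump in the same direction across every edge leaving `S`, and the
layer is flat on all other edges, so nothing cancels. -/
theorem totalVariation_sub_indicator [Fintype E] {h : V → ℝ} {c : ℝ} {S : Set V}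
    (hc : 0 ≤ c) (hS : ∀ v ∈ S, c ≤ h v) (hS' : ∀ v ∉ S, h v = 0) :
    G.totalVariation h = G.totalVariation (fun v => h v - c * S.indicator 1 v) +
      c * G.totalVariation (S.indicator 1) := by
  rw [totalVariation, totalVariation, totalVariation, Finset.mul_sum, ← Finset.sum_add_distrib]
  refine Finset.sum_congr rfl fun e _ => ?_
  rw [mul_left_comm, ← mul_add]
  congr 1
  by_cases hs : G.src e ∈ S <;> by_cases ht : G.tgt e ∈ S
  · simp [hs, ht]
  · have := hS _ hs
    simp [hs, ht, hS' _ ht, abs_of_nonneg (sub_nonneg.2 this), abs_of_nonneg (hc.trans this)]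
  · have := hS _ ht
    simp only [hs, ht, hS' _ hs, Set.indicator_of_mem, Set.indicator_of_notMem,
      not_false_eq_true, Pi.one_apply, mul_one, mul_zero, sub_zero, zero_sub, abs_neg, abs_one]
    rw [abs_of_nonneg (sub_nonneg.2 this), abs_of_nonneg (hc.trans this)]
    ring
  · simp [hs, ht, hS' _ hs, hS' _ ht]

/-- The Sobolev inequality for functions supported on at most half of the total mass. -/
theorem isoConst_mul_sobolevNorm_le [Fintype V] [Fintype E] (ν : ℝ≥0∞)
    (hα1 : (1 / ν).toReal < 1) (h : V → ℝ) (h0 : 0 ≤ h)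
    (hle : G.mass (Function.support h) ≤ G.mass (Function.support h)ᶜ) :
    G.isoConst ν * G.sobolevNorm (1 / ν).toReal h ≤ G.totalVariation h := by
  classical
  induction hn : (Function.support h).ncard using Nat.strong_induction_on generalizing h with
  | _ n ih =>
  set α := (1 / ν).toReal with hα
  have h1 : 0 < 1 - α := by linarith
  rcases (Function.support h).eq_empty_or_nonempty with hS | hS
  · rw [Function.support_eq_empty_iff] at hS
    subst hS
    have : G.sobolevNorm α 0 = 0 := by
      simp [sobolevNorm, Real.zero_rpow (inv_ne_zero h1.ne'), Real.zero_rpow h1.ne']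
    rw [this, mul_zero]
    exact G.totalVariation_nonneg _
  · set S := Function.support h with hSdef
    -- Removing the layer of height `h w`, the minimum on the support, kills `w`; the support
    -- shrinks strictly and still carries at most half the mass.
    obtain ⟨w, hw, hmin⟩ := Set.exists_min_image S h S.toFinite hS
    have hc : 0 < h w := lt_of_le_of_ne (h0 w) (Ne.symm hw)
    have hout : ∀ v ∉ S, h v = 0 := fun v hv => by simpa [hSdef] using hv
    set h' : V → ℝ := fun v => h v - h w * S.indicator 1 v with hh'
    have h'0 : 0 ≤ h' := fun v => by
      by_cases hv : v ∈ S
      · simpa [hh', hv] using hmin v hv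
      · simp [hh', hv, hout v hv]
    have hsub : Function.support h' ⊆ S := fun v hv => by
      by_contra hvS
      exact hv (by simp [hh', hvS, hout v hvS])
    have hssub : Function.support h' ⊂ S :=
      ⟨hsub, fun hh => hh hw (by simp [hh', hw])⟩
    have ih' := ih _ (hn ▸ Set.ncard_lt_ncard hssub S.toFinite) h' h'0
      ((G.mass_mono hsub).trans (hle.trans (G.mass_mono (Set.compl_subset_compl.2 hsub)))) rfl
    have hiso := mul_le_mul_of_nonneg_left (G.isoConst_mul_le_totalVariation ν hS hle) hc.le
    have hTV := G.totalVariation_sub_indicator hc.le hmin hout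
    have hadd : h = h' + fun v => h w * S.indicator 1 v := by
      funext v; simp [hh']
    have hN : G.sobolevNorm α h ≤ G.sobolevNorm α h' + h w * G.mass S ^ (1 - α) := by
      rw [← G.sobolevNorm_indicator hα1 hc.le S]
      conv_lhs => rw [hadd]
      exact G.sobolevNorm_add_le ENNReal.toReal_nonneg hα1 h'0 fun v =>
        mul_nonneg hc.le (Set.indicator_nonneg (fun _ _ => zero_le_one) v)
    have := mul_le_mul_of_nonneg_left hN (G.isoConst_nonneg ν)
    rw [hTV]
    linarith

/-! ### From total variation to energy -/

/-- The Dirichlet form on functions on the vertices. -/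
def dirichletForm [Fintype E] (f g : V → ℝ) : ℝ :=
  ∑ e, G.wt e / G.len e * ((f (G.src e) - f (G.tgt e)) * (g (G.src e) - g (G.tgt e)))

theorem dirichletForm_self_nonneg [Fintype E] (f : V → ℝ) : 0 ≤ G.dirichletForm f f :=
  Finset.sum_nonneg fun e _ =>
    mul_nonneg (div_pos (G.wt_pos e) (G.len_pos e)).le (mul_self_nonneg _)

theorem halfDegree_nonneg [Fintype E] (v : V) : 0 ≤ G.halfDegree v := by
  unfold halfDegree
  refine mul_nonneg (inv_nonneg.2 (G.vol_pos v).le) (Finset.sum_nonneg fun e _ => ?_)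
  split_ifs
  exacts [by have := G.wt_pos e; have := G.len_pos e; positivity, le_rfl]

theorem rhoSup_nonneg [Fintype E] : 0 ≤ G.rhoSup := Real.iSup_nonneg G.halfDegree_nonneg

theorem halfDegree_le_rhoSup [Fintype V] [Fintype E] (v : V) : G.halfDegree v ≤ G.rhoSup :=
  le_ciSup (Set.finite_range _).bddAbove v

open Classical in
-- Regrouped by vertices, `v` collects at most `2 * vol v * halfDegree v * g v ^ 2`. Loops, which
-- `halfDegree` counts only once, may be dropped because they carry no variation.
theorem sum_edge_sq_le [Fintype V] [Fintype E] (g : V → ℝ) :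
    ∑ e, (if G.src e = G.tgt e then 0 else G.wt e * G.len e *
      (g (G.src e) ^ 2 + g (G.tgt e) ^ 2)) ≤ 2 * G.rhoSup * ∑ v, G.vol v * g v ^ 2 := by
  calc _ ≤ ∑ e, ∑ v, (if G.src e = v ∨ G.tgt e = v then G.wt e * G.len e * g v ^ 2 else 0) := by
        refine Finset.sum_le_sum fun e _ => ?_
        have hp : 0 < G.wt e * G.len e := mul_pos (G.wt_pos e) (G.len_pos e)
        have hn : ∀ v, 0 ≤ if G.src e = v ∨ G.tgt e = v then
            G.wt e * G.len e * g v ^ 2 else 0 := fun v => by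
          split_ifs
          exacts [by positivity, le_rfl]
        split_ifs with h
        · exact Finset.sum_nonneg fun v _ => hn v
        · calc _ = ∑ v ∈ {G.src e, G.tgt e}, (if G.src e = v ∨ G.tgt e = v then
                G.wt e * G.len e * g v ^ 2 else 0) := by
                rw [Finset.sum_pair h]; simp; ring
            _ ≤ _ := Finset.sum_le_sum_of_subset_of_nonneg (Finset.subset_univ _)
                fun v _ _ => hn v
    _ = ∑ v, 2 * (G.vol v * g v ^ 2) * G.halfDegree v := by
        rw [Finset.sum_comm]
        refine Finset.sum_congr rfl fun v _ => ?_
        have := (G.vol_pos v).ne'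
        rw [halfDegree, ← mul_assoc, Finset.mul_sum]
        refine Finset.sum_congr rfl fun e _ => ?_
        split_ifs
        · field_simp
        · simp
    _ ≤ ∑ v, 2 * (G.vol v * g v ^ 2) * G.rhoSup := Finset.sum_le_sum fun v _ =>
        mul_le_mul_of_nonneg_left (G.halfDegree_le_rhoSup v)
          (by have := G.vol_pos v; positivity)
    _ = _ := by rw [← Finset.sum_mul, ← Finset.mul_sum]; ring

/-- Equality holds for equal signs; for opposite signs it reads a² + b² ≤ (|a| + |b|)². Treating
both parts together leaves a single Cauchy–Schwarz step. -/
theorem abs_sq_posPart_sub_add_le (a b : ℝ) :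
    |a⁺ ^ 2 - b⁺ ^ 2| + |a⁻ ^ 2 - b⁻ ^ 2| ≤ |a - b| * (|a| + |b|) := by
  rcases le_total 0 a with ha | ha <;> rcases le_total 0 b with hb | hb
  · rw [posPart_eq_self.2 ha, posPart_eq_self.2 hb, negPart_eq_zero.2 ha, negPart_eq_zero.2 hb,
      abs_of_nonneg ha, abs_of_nonneg hb, ← abs_of_nonneg (add_nonneg ha hb), ← abs_mul]
    ring_nf
    simp
  · rw [posPart_eq_self.2 ha, posPart_eq_zero.2 hb, negPart_eq_zero.2 ha, negPart_eq_neg.2 hb,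
      abs_of_nonneg ha, abs_of_nonpos hb, abs_of_nonneg (sub_nonneg.2 (hb.trans ha)),
      abs_of_nonneg (by nlinarith), abs_of_nonpos (by nlinarith)]
    nlinarith [mul_nonneg ha (neg_nonneg.2 hb)]
  · rw [posPart_eq_zero.2 ha, posPart_eq_self.2 hb, negPart_eq_neg.2 ha, negPart_eq_zero.2 hb,
      abs_of_nonpos ha, abs_of_nonneg hb, abs_of_nonpos (sub_nonpos.2 (ha.trans hb)),
      abs_of_nonneg (a := (-a) ^ 2 - 0 ^ 2) (by nlinarith), abs_of_nonpos (by nlinarith)]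
    nlinarith [mul_nonneg hb (neg_nonneg.2 ha)]
  · rw [posPart_eq_zero.2 ha, posPart_eq_zero.2 hb, negPart_eq_neg.2 ha, negPart_eq_neg.2 hb,
      abs_of_nonpos ha, abs_of_nonpos hb, ← abs_of_nonneg (a := -a + -b) (by linarith),
      ← abs_mul, ← abs_neg ((a - b) * _)]
    ring_nf
    simp

theorem totalVariation_posPart_add_negPart_sq_le [Fintype V] [Fintype E] (g : V → ℝ) :
    (G.totalVariation (fun v => (g v)⁺ ^ 2) + G.totalVariation (fun v => (g v)⁻ ^ 2)) ^ 2 ≤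
      G.dirichletForm g g * (4 * G.rhoSup * ∑ v, G.vol v * g v ^ 2) := by
  classical
  set S : E → ℝ := fun e => if G.src e = G.tgt e then 0 else |g (G.src e)| + |g (G.tgt e)|
  have h1 : G.totalVariation (fun v => (g v)⁺ ^ 2) + G.totalVariation (fun v => (g v)⁻ ^ 2) ≤
      ∑ e, (√(G.wt e / G.len e) * |g (G.src e) - g (G.tgt e)|) *
        (√(G.wt e * G.len e) * S e) := by
    rw [totalVariation, totalVariation, ← Finset.sum_add_distrib]
    refine Finset.sum_le_sum fun e _ => ?_
    have hw := G.wt_pos e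
    have hl := G.len_pos e
    have hsq : √(G.wt e / G.len e) * √(G.wt e * G.len e) = G.wt e := by
      rw [← Real.sqrt_mul (by positivity)]
      rw [show G.wt e / G.len e * (G.wt e * G.len e) = G.wt e ^ 2 by field_simp]
      exact Real.sqrt_sq hw.le
    rw [mul_mul_mul_comm, hsq, ← mul_add]
    refine mul_le_mul_of_nonneg_left ?_ hw.le
    by_cases h : G.src e = G.tgt e
    · simp [h]
    · simpa [S, h] using abs_sq_posPart_sub_add_le _ _
  have h0 : 0 ≤ G.totalVariation (fun v => (g v)⁺ ^ 2) +
      G.totalVariation (fun v => (g v)⁻ ^ 2) :=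
    add_nonneg (G.totalVariation_nonneg _) (G.totalVariation_nonneg _)
  -- Cauchy–Schwarz. The 4 below is 2 from (|a| + |b|)² ≤ 2(a² + b²) times 2 from `sum_edge_sq_le`.
  refine (pow_le_pow_left₀ h0 h1 2).trans ((Finset.sum_mul_sq_le_sq_mul_sq _ _ _).trans ?_)
  refine mul_le_mul (le_of_eq ?_) ?_ (Finset.sum_nonneg fun e _ => sq_nonneg _)
    (G.dirichletForm_self_nonneg g)
  · refine Finset.sum_congr rfl fun e _ => ?_
    rw [mul_pow, Real.sq_sqrt (div_pos (G.wt_pos e) (G.len_pos e)).le, sq_abs, sq]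
  · have := G.sum_edge_sq_le g
    refine le_trans ?_ (b := 2 * ∑ e, (if G.src e = G.tgt e then 0 else G.wt e * G.len e *
      (g (G.src e) ^ 2 + g (G.tgt e) ^ 2))) (by linarith)
    rw [Finset.mul_sum]
    refine Finset.sum_le_sum fun e _ => ?_
    have hp : 0 < G.wt e * G.len e := mul_pos (G.wt_pos e) (G.len_pos e)
    rw [mul_pow, Real.sq_sqrt hp.le]
    by_cases h : G.src e = G.tgt e
    · simp [S, h]
    · simp only [S, h, if_false]
      rw [mul_left_comm]
      refine mul_le_mul_of_nonneg_left ?_ hp.le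
      rw [← sq_abs (g (G.src e)), ← sq_abs (g (G.tgt e))]
      nlinarith [sq_nonneg (|g (G.src e)| - |g (G.tgt e)|)]

/-! ### Medians and the Nash inequality -/

/-- Every function has a median. -/
theorem exists_median [Fintype V] [Nonempty V] (f : V → ℝ) : ∃ c,
    G.mass {v | c < f v} ≤ G.mass {v | c < f v}ᶜ ∧
      G.mass {v | f v < c} ≤ G.mass {v | f v < c}ᶜ := by
  classical
  set T : Set V := {w | G.mass {v | f w < f v} ≤ G.mass {v | f w < f v}ᶜ}
  have hT : T.Nonempty := by
    obtain ⟨w, hw⟩ := Finite.exists_max f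
    refine ⟨w, ?_⟩
    have : {v | f w < f v} = ∅ := Set.eq_empty_of_forall_notMem fun v hv => (hw v).not_gt hv
    change G.mass _ ≤ G.mass _
    rw [this, mass_empty]
    exact G.mass_nonneg _
  -- The median is the least value with at most half the mass above it. The next smaller value `f u`
  -- fails this test, and what lies above `f u` is the complement of what lies below `f w`.
  obtain ⟨w, hw, hmin⟩ := Set.exists_min_image T f T.toFinite hT
  refine ⟨f w, hw, ?_⟩
  rcases Set.eq_empty_or_nonempty {v | f v < f w} with h | h
  · rw [h, mass_empty]
    exact G.mass_nonneg _
  · obtain ⟨u, hu, hmax⟩ := Set.exists_max_image _ f (Set.toFinite _) h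
    have hu' : u ∉ T := fun hT => (hmin u hT).not_gt hu
    have heq : {v | f v < f w} = {v | f u < f v}ᶜ := by
      ext v
      simp only [Set.mem_ofPred_eq, Set.mem_compl_iff, not_lt]
      exact ⟨fun hv => hmax v hv, fun hv => hv.trans_lt hu⟩
    rw [heq, compl_compl]
    exact (not_le.1 hu').le

theorem mass_mul [Fintype V] (c : ℝ) (S : Set V) :
    G.mass S * c = ∑ v, G.vol v * S.indicator (fun _ => c) v := by
  rw [mass, Finset.sum_mul]
  refine Finset.sum_congr rfl fun v _ => ?_
  by_cases hv : v ∈ S <;> simp [hv]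

/-- Subtracting `c` raises |f| by at most `c` where `f < c` and lowers it by exactly `c` elsewhere,
and the second set is at least as heavy. -/
theorem sum_abs_sub_le_of_mass_le [Fintype V] {f : V → ℝ} {c : ℝ} (hc : 0 ≤ c)
    (h : G.mass {v | f v < c} ≤ G.mass {v | f v < c}ᶜ) :
    ∑ v, G.vol v * |f v - c| ≤ ∑ v, G.vol v * |f v| := by
  have key : ∑ v, G.vol v * |f v - c| + G.mass {v | f v < c}ᶜ * c ≤
      ∑ v, G.vol v * |f v| + G.mass {v | f v < c} * c := by
    rw [mass_mul, mass_mul, ← Finset.sum_add_distrib, ← Finset.sum_add_distrib]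
    refine Finset.sum_le_sum fun v _ => ?_
    rw [← mul_add, ← mul_add]
    refine mul_le_mul_of_nonneg_left ?_ (G.vol_pos v).le
    by_cases hv : f v < c
    · simp only [Set.mem_compl_iff, Set.mem_ofPred_eq, hv, Set.indicator_of_mem, not_true,
        not_false_eq_true, Set.indicator_of_notMem, add_zero]
      calc |f v - c| ≤ |f v| + |c| := abs_sub _ _
        _ = _ := by rw [abs_of_nonneg hc]
    · simp only [Set.mem_compl_iff, Set.mem_ofPred_eq, hv, Set.indicator_of_mem,
        not_false_eq_true, Set.indicator_of_notMem, add_zero]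
      rw [abs_of_nonneg (by linarith), abs_of_nonneg (by linarith)]
      linarith
  have := mul_le_mul_of_nonneg_right h hc
  linarith

theorem sum_abs_sub_median_le [Fintype V] {f : V → ℝ} {c : ℝ}
    (h1 : G.mass {v | c < f v} ≤ G.mass {v | c < f v}ᶜ)
    (h2 : G.mass {v | f v < c} ≤ G.mass {v | f v < c}ᶜ) :
    ∑ v, G.vol v * |f v - c| ≤ ∑ v, G.vol v * |f v| := by
  rcases le_total 0 c with hc | hc
  · exact G.sum_abs_sub_le_of_mass_le hc h2
  · have h : {v | (-f) v < -c} = {v | c < f v} := by ext; simp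
    have := G.sum_abs_sub_le_of_mass_le (f := -f) (neg_nonneg.2 hc) (by rwa [h])
    have e : ∀ v, |-f v - -c| = |f v - c| := fun v => by
      rw [← abs_neg]; congr 1; ring
    simpa only [e, Pi.neg_apply, abs_neg] using this

theorem sum_sq_le_sum_sq_sub [Fintype V] {f : V → ℝ} (hf : ∑ v, G.vol v * f v = 0) (c : ℝ) :
    ∑ v, G.vol v * f v ^ 2 ≤ ∑ v, G.vol v * (f v - c) ^ 2 := by
  have : ∑ v, G.vol v * (f v - c) ^ 2 =
      ∑ v, G.vol v * f v ^ 2 - 2 * c * ∑ v, G.vol v * f v + ∑ v, G.vol v * c ^ 2 := by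
    rw [Finset.mul_sum, ← Finset.sum_sub_distrib, ← Finset.sum_add_distrib]
    exact Finset.sum_congr rfl fun v _ => by ring
  rw [this, hf]
  have : 0 ≤ ∑ v, G.vol v * c ^ 2 :=
    Finset.sum_nonneg fun v _ => mul_nonneg (G.vol_pos v).le (sq_nonneg c)
  linarith

theorem sum_vol_mul_nonneg [Fintype V] {f : V → ℝ} (hf : ∀ v, 0 ≤ f v) :
    0 ≤ ∑ v, G.vol v * f v :=
  Finset.sum_nonneg fun v _ => mul_nonneg (G.vol_pos v).le (hf v)

/-- Interpolation of the `ℓ²` norm between the `ℓ¹` norm and the Sobolev norm of the square. -/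
theorem sum_sq_rpow_le [Fintype V] {α : ℝ} (hα : 0 ≤ α) (hα1 : α < 1) (g : V → ℝ) :
    (∑ v, G.vol v * g v ^ 2) ^ (1 + α) ≤
      G.sobolevNorm α (fun v => g v ^ 2) * (∑ v, G.vol v * |g v|) ^ (2 * α) := by
  have h1 : 0 < 1 - α := by linarith
  have h2 : 0 < 1 + α := by linarith
  -- Hölder is used with weight `vol * |g|`. This `p` makes 1 + p = 2/(1 - α), the power in the
  -- Sobolev norm of g², and 1 - 1/p = 2α/(1 + α).
  set p : ℝ := (1 + α) / (1 - α) with hp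
  have hp1 : 1 ≤ p := by rw [hp, le_div_iff₀ h1]; linarith
  have hp' : p⁻¹ = (1 - α) / (1 + α) := by rw [hp, inv_div]
  have holder := Real.inner_le_weight_mul_Lp_of_nonneg Finset.univ hp1
    (fun v => G.vol v * |g v|) (fun v => |g v|)
    (fun v => mul_nonneg (G.vol_pos v).le (abs_nonneg _)) (fun v => abs_nonneg _)
  have e1 : ∀ v, G.vol v * |g v| * |g v| = G.vol v * g v ^ 2 := fun v => by
    rw [mul_assoc, abs_mul_abs_self, sq]
  have e2 : ∀ v, G.vol v * |g v| * |g v| ^ p = G.vol v * (g v ^ 2) ^ (1 / (1 - α)) := fun v => by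
    rw [mul_assoc, ← sq_abs, ← Real.rpow_natCast, ← Real.rpow_mul (abs_nonneg _)]
    congr 1
    rw [← Real.rpow_one_add' (abs_nonneg _) (by positivity)]
    congr 1
    rw [hp]
    field_simp
    push_cast
    ring
  simp only [e1, e2] at holder
  have hX : 0 ≤ ∑ v, G.vol v * g v ^ 2 := G.sum_vol_mul_nonneg fun v => sq_nonneg _
  have hY : 0 ≤ ∑ v, G.vol v * |g v| := G.sum_vol_mul_nonneg fun v => abs_nonneg _
  have hN : 0 ≤ ∑ v, G.vol v * (g v ^ 2) ^ (1 / (1 - α)) :=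
    G.sum_vol_mul_nonneg fun v => Real.rpow_nonneg (sq_nonneg _) _
  refine (Real.rpow_le_rpow hX holder h2.le).trans (le_of_eq ?_)
  rw [Real.mul_rpow (Real.rpow_nonneg hY _) (Real.rpow_nonneg hN _), ← Real.rpow_mul hY,
    ← Real.rpow_mul hN, sobolevNorm, mul_comm, hp']
  congr 2 <;> field_simp
  ring

/-- The constant `Ĩ_ν ρ_sup ^ (-1/2) / 2`. -/
def cheegerConst [Fintype V] [Fintype E] (ν : ℝ≥0∞) : ℝ :=
  G.isoConst ν * G.rhoSup ^ (-(1 / 2) : ℝ) / 2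

theorem cheegerConst_nonneg [Fintype V] [Fintype E] (ν : ℝ≥0∞) : 0 ≤ G.cheegerConst ν :=
  div_nonneg (mul_nonneg (G.isoConst_nonneg ν) (Real.rpow_nonneg G.rhoSup_nonneg _)) zero_le_two

theorem cheegerConst_sq_mul_le [Fintype V] [Fintype E] (ν : ℝ≥0∞) (hα1 : (1 / ν).toReal < 1)
    {g : V → ℝ} (h1 : G.mass {v | 0 < g v} ≤ G.mass {v | 0 < g v}ᶜ)
    (h2 : G.mass {v | g v < 0} ≤ G.mass {v | g v < 0}ᶜ) :
    G.cheegerConst ν ^ 2 * G.sobolevNorm (1 / ν).toReal (fun v => g v ^ 2) ^ 2 ≤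
      G.dirichletForm g g * ∑ v, G.vol v * g v ^ 2 := by
  have hX : 0 ≤ ∑ v, G.vol v * g v ^ 2 := G.sum_vol_mul_nonneg fun v => sq_nonneg _
  -- For `rhoSup = 0` the real power `0 ^ (-1/2)` is `0`, so the constant vanishes.
  rcases G.rhoSup_nonneg.eq_or_lt with hρ | hρ
  · have : G.cheegerConst ν = 0 := by
      rw [cheegerConst, ← hρ, Real.zero_rpow (by norm_num)]; simp
    rw [this]
    simpa using mul_nonneg (G.dirichletForm_self_nonneg g) hX
  set α := (1 / ν).toReal
  have hp : Function.support (fun v => (g v)⁺ ^ 2) = {v | 0 < g v} := by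
    ext v; simp [posPart_eq_zero]
  have hm : Function.support (fun v => (g v)⁻ ^ 2) = {v | g v < 0} := by
    ext v; simp [negPart_eq_zero]
  have hp0 : 0 ≤ fun v => (g v)⁺ ^ 2 := fun v => sq_nonneg _
  have hm0 : 0 ≤ fun v => (g v)⁻ ^ 2 := fun v => sq_nonneg _
  have sp := G.isoConst_mul_sobolevNorm_le ν hα1 _ hp0 (by rwa [hp])
  have sm := G.isoConst_mul_sobolevNorm_le ν hα1 _ hm0 (by rwa [hm])
  have hsum : (fun v => g v ^ 2) = (fun v => (g v)⁺ ^ 2) + fun v => (g v)⁻ ^ 2 := by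
    funext v
    rcases le_total 0 (g v) with h | h
    · simp [posPart_eq_self.2 h, negPart_eq_zero.2 h]
    · simp [posPart_eq_zero.2 h, negPart_eq_neg.2 h]
  have tri := G.sobolevNorm_add_le ENNReal.toReal_nonneg hα1 hp0 hm0
  rw [← hsum] at tri
  have hI := mul_le_mul_of_nonneg_left tri (G.isoConst_nonneg ν)
  have hle : G.isoConst ν * G.sobolevNorm α (fun v => g v ^ 2) ≤
      G.totalVariation (fun v => (g v)⁺ ^ 2) + G.totalVariation (fun v => (g v)⁻ ^ 2) := by
    linarith
  have hN := G.sobolevNorm_nonneg α (h := fun v => g v ^ 2) fun v => sq_nonneg _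
  have hsq := (pow_le_pow_left₀ (mul_nonneg (G.isoConst_nonneg ν) hN) hle 2).trans
    (G.totalVariation_posPart_add_negPart_sq_le g)
  have hr : (G.rhoSup ^ (-(1 / 2) : ℝ)) ^ 2 = G.rhoSup⁻¹ := by
    rw [← Real.rpow_natCast, ← Real.rpow_mul hρ.le, ← Real.rpow_neg_one]
    norm_num
  rw [cheegerConst, div_pow, mul_pow, hr]
  rw [mul_pow] at hsq
  calc G.isoConst ν ^ 2 * G.rhoSup⁻¹ / 2 ^ 2 * G.sobolevNorm α (fun v => g v ^ 2) ^ 2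
      = (G.isoConst ν ^ 2 * G.sobolevNorm α (fun v => g v ^ 2) ^ 2) / (4 * G.rhoSup) := by
        field_simp; ring
    _ ≤ _ := by
        rw [div_le_iff₀ (by positivity)]
        linarith

/-- The Nash inequality. -/
theorem nash_inequality [Fintype V] [Fintype E] [Nonempty V] (ν : ℝ≥0∞)
    (hα1 : (1 / ν).toReal < 1) {f : V → ℝ} (hf : ∑ v, G.vol v * f v = 0) :
    G.cheegerConst ν ^ 2 * (∑ v, G.vol v * f v ^ 2) ^ (1 + 2 * (1 / ν).toReal) ≤
      G.dirichletForm f f * (∑ v, G.vol v * |f v|) ^ (4 * (1 / ν).toReal) := by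
  -- Shifting by the median keeps the energy, does not increase the ℓ¹ norm, and does not decrease
  -- the ℓ² norm because `f` has mean zero. All three go the right way.
  obtain ⟨c, h1, h2⟩ := G.exists_median f
  set g : V → ℝ := fun v => f v - c with hg
  have hα : 0 ≤ (1 / ν).toReal := ENNReal.toReal_nonneg
  have hXf : 0 ≤ ∑ v, G.vol v * f v ^ 2 := G.sum_vol_mul_nonneg fun v => sq_nonneg _
  have hXg : 0 ≤ ∑ v, G.vol v * g v ^ 2 := G.sum_vol_mul_nonneg fun v => sq_nonneg _
  have hY : 0 ≤ ∑ v, G.vol v * |g v| := G.sum_vol_mul_nonneg fun v => abs_nonneg _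
  have hE : G.dirichletForm g g = G.dirichletForm f f := by simp [dirichletForm, hg]
  have hEn := G.dirichletForm_self_nonneg f
  have hX : ∑ v, G.vol v * f v ^ 2 ≤ ∑ v, G.vol v * g v ^ 2 := G.sum_sq_le_sum_sq_sub hf c
  have hYle : ∑ v, G.vol v * |g v| ≤ ∑ v, G.vol v * |f v| := G.sum_abs_sub_median_le h1 h2
  have key := G.cheegerConst_sq_mul_le ν hα1 (g := g) (by simpa [hg] using h1)
    (by simpa [hg] using h2)
  have interp := G.sum_sq_rpow_le hα hα1 g
  rw [hE] at key
  set α := (1 / ν).toReal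
  set X := ∑ v, G.vol v * g v ^ 2
  set Y := ∑ v, G.vol v * |g v|
  have hfin : G.cheegerConst ν ^ 2 * X ^ (1 + 2 * α) ≤ G.dirichletForm f f * Y ^ (4 * α) := by
    rcases hXg.eq_or_lt with h0 | h0
    · rw [← h0, Real.zero_rpow (by positivity), mul_zero]
      exact mul_nonneg hEn (Real.rpow_nonneg hY _)
    · have hsq := pow_le_pow_left₀ (Real.rpow_nonneg hXg _) interp 2
      have e1 : (X ^ (1 + α)) ^ 2 = X ^ (1 + 2 * α) * X := by
        rw [← Real.rpow_natCast, ← Real.rpow_mul hXg, ← Real.rpow_add_one h0.ne']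
        congr 1
        push_cast
        ring
      have e2 : (Y ^ (2 * α)) ^ 2 = Y ^ (4 * α) := by
        rw [← Real.rpow_natCast, ← Real.rpow_mul hY]
        congr 1
        push_cast
        ring
      rw [mul_pow, e1, e2] at hsq
      refine le_of_mul_le_mul_right ?_ h0
      calc G.cheegerConst ν ^ 2 * X ^ (1 + 2 * α) * X
          ≤ G.cheegerConst ν ^ 2 *
            (G.sobolevNorm α (fun v => g v ^ 2) ^ 2 * Y ^ (4 * α)) := by
            rw [mul_assoc]
            exact mul_le_mul_of_nonneg_left hsq (sq_nonneg _)
        _ ≤ G.dirichletForm f f * X * Y ^ (4 * α) := by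
            rw [← mul_assoc]
            exact mul_le_mul_of_nonneg_right key (Real.rpow_nonneg hY _)
        _ = _ := by ring
  calc _ ≤ G.cheegerConst ν ^ 2 * X ^ (1 + 2 * α) := mul_le_mul_of_nonneg_left
        (Real.rpow_le_rpow hXf hX (by positivity)) (sq_nonneg _)
    _ ≤ _ := hfin
    _ ≤ _ := mul_le_mul_of_nonneg_left (Real.rpow_le_rpow hY hYle (by positivity)) hEn

/-! ### Spectral decomposition of the Laplacian -/

theorem laplacian_apply [DecidableEq V] [Fintype E] (f : V → ℝ) (v : V) :
    G.laplacian f v = (G.vol v)⁻¹ * ∑ e, G.wt e / G.len e *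
      ((if G.src e = v then f v - f (G.tgt e) else 0) +
        (if G.tgt e = v then f v - f (G.src e) else 0)) := by
  simp only [laplacian, LinearMap.coe_mk, AddHom.coe_mk]
  congr!

/-- Green's formula: the two end terms of each edge combine into a product of differences. -/
theorem sum_vol_mul_laplacian [Fintype V] [Fintype E] (f g : V → ℝ) :
    ∑ v, G.vol v * (f v * G.laplacian g v) = G.dirichletForm f g := by
  classical
  calc ∑ v, G.vol v * (f v * G.laplacian g v)
      = ∑ v, ∑ e, G.wt e / G.len e *
        ((if G.src e = v then f v * (g v - g (G.tgt e)) else 0) +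
          (if G.tgt e = v then f v * (g v - g (G.src e)) else 0)) := by
        refine Finset.sum_congr rfl fun v _ => ?_
        rw [laplacian_apply, mul_left_comm (f v), mul_inv_cancel_left₀ (G.vol_pos v).ne',
          Finset.mul_sum]
        refine Finset.sum_congr rfl fun e _ => ?_
        rw [mul_left_comm, mul_add, mul_ite, mul_ite, mul_zero]
    _ = _ := by
        rw [Finset.sum_comm]
        refine Finset.sum_congr rfl fun e _ => ?_
        rw [← Finset.mul_sum, Finset.sum_add_distrib, Finset.sum_ite_eq, Finset.sum_ite_eq]
        simp only [Finset.mem_univ, if_true]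
        ring

theorem dirichletForm_comm [Fintype E] (f g : V → ℝ) :
    G.dirichletForm f g = G.dirichletForm g f :=
  Finset.sum_congr rfl fun e _ => by ring

/-- An eigenbasis of the Laplacian that is orthonormal for the vertex measure. -/
structure Eigenbasis [Fintype V] [Fintype E] [DecidableEq V] where
  fn : V → V → ℝ
  eig : V → ℝ
  laplacian_fn : ∀ i, G.laplacian (fn i) = eig i • fn i
  orthonormal : ∀ i j, ∑ x, G.vol x * (fn i x * fn j x) = if i = j then 1 else 0
  complete : ∀ x y, ∑ i, fn i x * fn i y = if x = y then (G.vol x)⁻¹ else 0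
  roots_eq : G.laplacian.charpoly.roots = Finset.univ.val.map eig

/-- The Laplacian is symmetric only for the vertex measure. Conjugation by diag(√vol) makes it
Hermitian without changing the characteristic polynomial; the eigenvectors are then divided by √vol.
-/
theorem nonempty_eigenbasis [Fintype V] [Fintype E] [DecidableEq V] : Nonempty G.Eigenbasis := by
  set r : V → ℝ := fun v => √(G.vol v) with hr
  have hr0 : ∀ v, r v ≠ 0 := fun v => (Real.sqrt_pos.2 (G.vol_pos v)).ne'
  have hrr : ∀ v, r v * r v = G.vol v := fun v => Real.mul_self_sqrt (G.vol_pos v).le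
  set M : Matrix V V ℝ := LinearMap.toMatrix' G.laplacian with hM
  have hMv : ∀ f, M.mulVec f = G.laplacian f := fun f => by
    rw [hM, LinearMap.toMatrix'_mulVec]
  have hsymm : ∀ x y, G.vol x * M x y = G.vol y * M y x := by
    have key : ∀ x y, G.vol x * M x y =
        G.dirichletForm (Pi.single x 1) (Pi.single y 1) := fun x y => by
      rw [← sum_vol_mul_laplacian, Finset.sum_eq_single x]
      · simp [hM, LinearMap.toMatrix'_apply]
      · intro z _ hz
        simp [hz]
      · simp
    intro x y
    rw [key, key, dirichletForm_comm]
  let D : (Matrix V V ℝ)ˣ := ⟨Matrix.diagonal r, Matrix.diagonal r⁻¹,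
    by rw [Matrix.diagonal_mul_diagonal, ← Matrix.diagonal_one]; congr 1; funext v; simp [hr0 v],
    by rw [Matrix.diagonal_mul_diagonal, ← Matrix.diagonal_one]; congr 1; funext v; simp [hr0 v]⟩
  set S : Matrix V V ℝ := D.val * M * D⁻¹.val with hS
  have hSxy : ∀ x y, S x y = r x * M x y * (r y)⁻¹ := fun x y => by
    change (Matrix.diagonal r * M * Matrix.diagonal r⁻¹) x y = _
    rw [Matrix.mul_diagonal, Matrix.diagonal_mul, Pi.inv_apply]
  have hH : S.IsHermitian := by
    ext x y
    rw [Matrix.conjTranspose_apply, star_trivial, hSxy, hSxy]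
    have h := hsymm x y
    rw [← hrr x, ← hrr y] at h
    have := hr0 x
    have := hr0 y
    field_simp
    linarith
  have hMS : ∀ f, M.mulVec (D⁻¹.val.mulVec f) = D⁻¹.val.mulVec (S.mulVec f) := fun f => by
    rw [hS, Matrix.mulVec_mulVec, Matrix.mulVec_mulVec, ← mul_assoc, ← mul_assoc,
      Units.inv_mul, one_mul]
  have hDv : ∀ f x, D⁻¹.val.mulVec f x = (r x)⁻¹ * f x := fun f x => by
    change (Matrix.diagonal r⁻¹).mulVec f x = _
    rw [Matrix.mulVec_diagonal, Pi.inv_apply]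
  set U : Matrix V V ℝ := (hH.eigenvectorUnitary : Matrix V V ℝ) with hU
  have hUU : U * star U = 1 := Unitary.coe_mul_star_self hH.eigenvectorUnitary
  have hUU' : star U * U = 1 := Unitary.coe_star_mul_self hH.eigenvectorUnitary
  have hUi : ∀ i, (fun x => U x i) = ⇑(hH.eigenvectorBasis i) := fun i => rfl
  refine ⟨⟨fun i => D⁻¹.val.mulVec fun x => U x i, hH.eigenvalues, ?_, ?_, ?_, ?_⟩⟩
  · intro i
    rw [← hMv, hMS, hUi, hH.mulVec_eigenvectorBasis, Matrix.mulVec_smul]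
  · intro i j
    rw [← Matrix.one_apply, ← hUU', Matrix.mul_apply]
    refine Finset.sum_congr rfl fun x _ => ?_
    rw [hDv, hDv, ← hrr, Matrix.star_apply, star_trivial]
    have := hr0 x
    field_simp
  · intro x y
    have h := congrFun (congrFun hUU x) y
    rw [Matrix.mul_apply, Matrix.one_apply] at h
    simp only [Matrix.star_apply, star_trivial] at h
    simp only [hDv]
    calc _ = (r x)⁻¹ * (r y)⁻¹ * ∑ i, U x i * U y i := by
          rw [Finset.mul_sum]
          exact Finset.sum_congr rfl fun i _ => by ring
      _ = _ := by
          rw [h]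
          split_ifs with hxy
          · rw [← hxy, mul_one, ← mul_inv, hrr]
          · rw [mul_zero]
  · rw [← LinearMap.charpoly_toMatrix G.laplacian (Pi.basisFun ℝ V),
      LinearMap.toMatrix_eq_toMatrix', ← hM, ← Matrix.charpoly_units_conj D M,
      ← Matrix.coe_units_inv, ← hS, hH.roots_charpoly_eq_eigenvalues]
    rfl

namespace Eigenbasis

variable {G} [Fintype V] [Fintype E] [DecidableEq V] (B : G.Eigenbasis)

theorem sum_vol_mul_sum_mul_sum (a b : V → ℝ) :
    ∑ x, G.vol x * ((∑ i, a i * B.fn i x) * ∑ i, b i * B.fn i x) = ∑ i, a i * b i := by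
  calc _ = ∑ x, ∑ i, ∑ j, a i * b j * (G.vol x * (B.fn i x * B.fn j x)) := by
        refine Finset.sum_congr rfl fun x _ => ?_
        rw [Finset.sum_mul_sum, Finset.mul_sum]
        refine Finset.sum_congr rfl fun i _ => ?_
        rw [Finset.mul_sum]
        exact Finset.sum_congr rfl fun j _ => by ring
    _ = ∑ i, ∑ j, a i * b j * ∑ x, G.vol x * (B.fn i x * B.fn j x) := by
        rw [Finset.sum_comm]
        refine Finset.sum_congr rfl fun i _ => ?_
        rw [Finset.sum_comm]
        exact Finset.sum_congr rfl fun j _ => by rw [Finset.mul_sum]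
    _ = _ := by simp [B.orthonormal]

theorem laplacian_sum (a : V → ℝ) :
    G.laplacian (fun x => ∑ i, a i * B.fn i x) = fun x => ∑ i, a i * B.eig i * B.fn i x := by
  have : (fun x => ∑ i, a i * B.fn i x) = ∑ i, a i • B.fn i := by
    funext x; simp [Finset.sum_apply]
  rw [this, map_sum]
  funext x
  simp [Finset.sum_apply, B.laplacian_fn, mul_assoc]

theorem dirichletForm_sum (a : V → ℝ) :
    G.dirichletForm (fun x => ∑ i, a i * B.fn i x) (fun x => ∑ i, a i * B.fn i x) =
      ∑ i, B.eig i * a i ^ 2 := by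
  rw [← sum_vol_mul_laplacian, B.laplacian_sum, B.sum_vol_mul_sum_mul_sum]
  exact Finset.sum_congr rfl fun i _ => by ring

theorem dirichletForm_fn (i : V) : G.dirichletForm (B.fn i) (B.fn i) = B.eig i := by
  have := B.dirichletForm_sum (Pi.single i 1)
  simpa [Pi.single_apply] using this

theorem eig_nonneg (i : V) : 0 ≤ B.eig i := by
  rw [← B.dirichletForm_fn]
  exact G.dirichletForm_self_nonneg _

/-- The integral of an eigenfunction. -/
def integral (i : V) : ℝ := ∑ x, G.vol x * B.fn i x

/-- Test the eigenvalue equation against the constant 1, which has no energy. Connectedness is not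
needed. -/
theorem eig_mul_integral (i : V) : B.eig i * B.integral i = 0 := by
  have h := G.sum_vol_mul_laplacian (fun _ => 1) (B.fn i)
  simp only [B.laplacian_fn, dirichletForm, sub_self, zero_mul, mul_zero,
    Finset.sum_const_zero, Pi.smul_apply, smul_eq_mul, one_mul] at h
  rw [integral, Finset.mul_sum, ← h]
  exact Finset.sum_congr rfl fun x _ => by ring

/-- The expansion of the constant function 1 in the eigenbasis. -/
theorem sum_integral_mul (x : V) : ∑ i, B.integral i * B.fn i x = 1 := by
  calc _ = ∑ y, G.vol y * ∑ i, B.fn i y * B.fn i x := by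
        simp only [integral, Finset.sum_mul, Finset.mul_sum]
        rw [Finset.sum_comm]
        exact Finset.sum_congr rfl fun y _ => Finset.sum_congr rfl fun i _ => by ring
    _ = 1 := by simp [B.complete, (G.vol_pos x).ne']

theorem exists_eig_eq_zero [Nonempty V] : ∃ i, B.eig i = 0 := by
  by_contra! h
  have h0 : ∀ i, B.integral i = 0 := fun i =>
    (mul_eq_zero.1 (B.eig_mul_integral i)).resolve_left (h i)
  have := B.sum_integral_mul (Classical.arbitrary V)
  simp [h0] at this

theorem sum_vol_mul_sum_sq (a : V → ℝ) :
    ∑ x, G.vol x * ∑ i, a i * B.fn i x ^ 2 = ∑ i, a i := by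
  simp only [Finset.mul_sum]
  rw [Finset.sum_comm]
  refine Finset.sum_congr rfl fun i _ => ?_
  have := B.orthonormal i i
  rw [if_pos rfl] at this
  calc _ = a i * ∑ x, G.vol x * (B.fn i x * B.fn i x) := by
        rw [Finset.mul_sum]
        exact Finset.sum_congr rfl fun x _ => by ring
    _ = a i := by rw [this, mul_one]

end Eigenbasis

end

end ClosedGraph

namespace ClosedGraph

noncomputable section

variable {V E : Type*} {G : ClosedGraph V E}

/-! ### The heat kernel -/

theorem sum_vol_pos [Fintype V] [Nonempty V] : 0 < ∑ v, G.vol v :=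
  Finset.sum_pos (fun v _ => G.vol_pos v) Finset.univ_nonempty

/-- Off-diagonal entries of Δ are nonpositive, so d - Δ preserves positivity once `d` dominates the
diagonal. This is what makes the heat kernel nonnegative. -/
theorem exists_laplacian_le [Fintype V] [Fintype E] : ∃ d : ℝ,
    ∀ f : V → ℝ, 0 ≤ f → ∀ x, G.laplacian f x ≤ d * f x := by
  classical
  set b : V → ℝ := fun x => (G.vol x)⁻¹ * ∑ e, G.wt e / G.len e * 2 with hb
  have hc : ∀ e, 0 ≤ G.wt e / G.len e := fun e => (div_pos (G.wt_pos e) (G.len_pos e)).le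
  have hb0 : ∀ x, 0 ≤ b x := fun x => mul_nonneg (inv_nonneg.2 (G.vol_pos x).le)
    (Finset.sum_nonneg fun e _ => mul_nonneg (hc e) zero_le_two)
  refine ⟨∑ x, b x, fun f hf x => ?_⟩
  refine le_trans ?_ (mul_le_mul_of_nonneg_right
    (Finset.single_le_sum (fun x _ => hb0 x) (Finset.mem_univ x)) (hf x))
  rw [laplacian_apply, hb, mul_assoc, Finset.sum_mul]
  refine mul_le_mul_of_nonneg_left (Finset.sum_le_sum fun e _ => ?_)
    (inv_nonneg.2 (G.vol_pos x).le)
  rw [mul_assoc]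
  refine mul_le_mul_of_nonneg_left ?_ (hc e)
  have h1 := hf (G.src e)
  have h2 := hf (G.tgt e)
  have h3 := hf x
  simp only [Pi.zero_apply] at h1 h2 h3
  split_ifs <;> linarith

namespace Eigenbasis

variable [Fintype V] [Fintype E] [DecidableEq V] (B : G.Eigenbasis)

/-- The heat kernel. -/
def heat (t : ℝ) (x y : V) : ℝ := ∑ i, Real.exp (-(t * B.eig i)) * B.fn i x * B.fn i y

/-- This is the kernel of (c - tΔ)^n: a point mass for n = 0, then repeated application of a
positivity preserving operator. -/
theorem sum_sub_pow_mul_nonneg {c t d : ℝ} (ht : 0 ≤ t) (hd : t * d ≤ c)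
    (hG : ∀ f : V → ℝ, 0 ≤ f → ∀ x, G.laplacian f x ≤ d * f x) (x : V) (n : ℕ) :
    0 ≤ fun y => ∑ i, (c - t * B.eig i) ^ n * B.fn i x * B.fn i y := by
  induction n with
  | zero =>
    intro y
    simp only [pow_zero, one_mul, B.complete, Pi.zero_apply]
    split_ifs
    exacts [inv_nonneg.2 (G.vol_pos x).le, le_rfl]
  | succ n ih =>
    intro y
    have hL := hG _ ih y
    have hy := ih y
    rw [B.laplacian_sum] at hL
    have : ∑ i, (c - t * B.eig i) ^ (n + 1) * B.fn i x * B.fn i y =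
        c * ∑ i, (c - t * B.eig i) ^ n * B.fn i x * B.fn i y -
          t * ∑ i, (c - t * B.eig i) ^ n * B.fn i x * B.eig i * B.fn i y := by
      rw [Finset.mul_sum, Finset.mul_sum, ← Finset.sum_sub_distrib]
      exact Finset.sum_congr rfl fun i _ => by ring
    simp only [Pi.zero_apply] at hy ⊢
    rw [this]
    have h1 := mul_le_mul_of_nonneg_left hL ht
    have h2 := mul_le_mul_of_nonneg_right hd hy
    linarith

/-- Up to the factor e^(td), the kernel is that of exp(td - tΔ), whose power series has nonnegative
terms. -/
theorem heat_nonneg {t : ℝ} (ht : 0 ≤ t) (x y : V) : 0 ≤ B.heat t x y := by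
  obtain ⟨d, hG⟩ := exists_laplacian_le (G := G)
  have hsum : HasSum (fun n : ℕ => ∑ i, (t * d - t * B.eig i) ^ n / (n.factorial : ℝ) *
      (B.fn i x * B.fn i y)) (∑ i, Real.exp (t * d - t * B.eig i) * (B.fn i x * B.fn i y)) := by
    refine hasSum_sum fun i _ => HasSum.mul_right _ ?_
    rw [Real.exp_eq_exp_ℝ]
    exact NormedSpace.expSeries_div_hasSum_exp _
  have hnn : 0 ≤ ∑ i, Real.exp (t * d - t * B.eig i) * (B.fn i x * B.fn i y) := by
    refine hsum.nonneg fun n => ?_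
    have h := B.sum_sub_pow_mul_nonneg ht le_rfl hG x n y
    have e : ∑ i, (t * d - t * B.eig i) ^ n / (n.factorial : ℝ) * (B.fn i x * B.fn i y) =
        (∑ i, (t * d - t * B.eig i) ^ n * B.fn i x * B.fn i y) / n.factorial := by
      rw [Finset.sum_div]
      exact Finset.sum_congr rfl fun i _ => by ring
    rw [e]
    exact div_nonneg h (Nat.cast_nonneg _)
  have e : ∑ i, Real.exp (t * d - t * B.eig i) * (B.fn i x * B.fn i y) =
      Real.exp (t * d) * B.heat t x y := by
    rw [heat, Finset.mul_sum]
    refine Finset.sum_congr rfl fun i _ => ?_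
    rw [sub_eq_add_neg, Real.exp_add]
    ring
  rw [e] at hnn
  exact nonneg_of_mul_nonneg_right hnn (Real.exp_pos _)

/-- Only eigenfunctions with eigenvalue 0 have nonzero integral, and these do not decay. -/
theorem sum_vol_mul_heat (t : ℝ) (x : V) : ∑ y, G.vol y * B.heat t x y = 1 := by
  rw [← B.sum_integral_mul x]
  simp only [heat, Finset.mul_sum]
  rw [Finset.sum_comm]
  refine Finset.sum_congr rfl fun i _ => ?_
  calc _ = Real.exp (-(t * B.eig i)) * B.integral i * B.fn i x := by
        rw [integral, Finset.mul_sum, Finset.sum_mul]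
        exact Finset.sum_congr rfl fun y _ => by ring
    _ = _ := by
        rcases mul_eq_zero.1 (B.eig_mul_integral i) with h | h <;> simp [h]

/-- The heat kernel minus its equilibrium. -/
def heatDefect (t : ℝ) (x y : V) : ℝ := B.heat t x y - 1 / ∑ v, G.vol v

/-- The square of the norm of `heatDefect`. -/
def heatEnergy (x : V) (t : ℝ) : ℝ :=
  ∑ i, Real.exp (-(2 * t * B.eig i)) * B.fn i x ^ 2 - 1 / ∑ v, G.vol v

theorem sum_vol_mul_heatDefect [Nonempty V] (t : ℝ) (x : V) :
    ∑ y, G.vol y * B.heatDefect t x y = 0 := by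
  simp only [heatDefect, mul_sub, Finset.sum_sub_distrib, sum_vol_mul_heat, ← Finset.sum_mul]
  rw [mul_one_div_cancel (sum_vol_pos (G := G)).ne', sub_self]

/-- A difference of two probability densities; this 2 is the source of the factor 2^(-4/ν). -/
theorem sum_vol_mul_abs_heatDefect_le [Nonempty V] {t : ℝ} (ht : 0 ≤ t) (x : V) :
    ∑ y, G.vol y * |B.heatDefect t x y| ≤ 2 := by
  have hV := sum_vol_pos (G := G)
  calc _ ≤ ∑ y, G.vol y * (B.heat t x y + 1 / ∑ v, G.vol v) := by
        refine Finset.sum_le_sum fun y _ => mul_le_mul_of_nonneg_left ?_ (G.vol_pos y).le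
        refine (abs_sub _ _).trans (le_of_eq ?_)
        rw [abs_of_nonneg (B.heat_nonneg ht x y), abs_of_nonneg (by positivity)]
    _ = 2 := by
        simp only [mul_add, Finset.sum_add_distrib, sum_vol_mul_heat, ← Finset.sum_mul]
        rw [mul_one_div_cancel hV.ne']
        norm_num

theorem sum_vol_mul_heatDefect_sq [Nonempty V] (t : ℝ) (x : V) :
    ∑ y, G.vol y * B.heatDefect t x y ^ 2 = B.heatEnergy x t := by
  have hV := sum_vol_pos (G := G)
  set c := 1 / ∑ v, G.vol v with hc
  have hcV : (∑ v, G.vol v) * c = 1 := mul_one_div_cancel hV.ne'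
  have h1 : ∑ y, G.vol y * (B.heat t x y * B.heat t x y) =
      ∑ i, Real.exp (-(2 * t * B.eig i)) * B.fn i x ^ 2 := by
    simp only [heat]
    rw [B.sum_vol_mul_sum_mul_sum]
    refine Finset.sum_congr rfl fun i _ => ?_
    rw [show -(2 * t * B.eig i) = -(t * B.eig i) + -(t * B.eig i) by ring, Real.exp_add]
    ring
  calc ∑ y, G.vol y * B.heatDefect t x y ^ 2
      = ∑ y, G.vol y * (B.heat t x y * B.heat t x y) - 2 * c * ∑ y, G.vol y * B.heat t x y +
          (∑ y, G.vol y) * c * c := by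
        rw [Finset.mul_sum, Finset.sum_mul, Finset.sum_mul, ← Finset.sum_sub_distrib,
          ← Finset.sum_add_distrib]
        refine Finset.sum_congr rfl fun y _ => ?_
        rw [heatDefect]
        ring
    _ = _ := by
        rw [h1, sum_vol_mul_heat, hcV, heatEnergy]
        ring

theorem dirichletForm_heatDefect (t : ℝ) (x : V) :
    G.dirichletForm (B.heatDefect t x) (B.heatDefect t x) =
      ∑ i, B.eig i * Real.exp (-(2 * t * B.eig i)) * B.fn i x ^ 2 := by
  have h : G.dirichletForm (B.heatDefect t x) (B.heatDefect t x) =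
      G.dirichletForm (B.heat t x) (B.heat t x) := by simp [dirichletForm, heatDefect]
  have h' : B.heat t x = fun y => ∑ i, Real.exp (-(t * B.eig i)) * B.fn i x * B.fn i y := rfl
  rw [h, h', B.dirichletForm_sum]
  refine Finset.sum_congr rfl fun i _ => ?_
  rw [show -(2 * t * B.eig i) = -(t * B.eig i) + -(t * B.eig i) by ring, Real.exp_add]
  ring

theorem hasDerivAt_heatEnergy (x : V) (t : ℝ) :
    HasDerivAt (B.heatEnergy x)
      (-2 * G.dirichletForm (B.heatDefect t x) (B.heatDefect t x)) t := by
  rw [dirichletForm_heatDefect, Finset.mul_sum]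
  refine HasDerivAt.sub_const _ (HasDerivAt.fun_sum fun i _ => ?_)
  have h : HasDerivAt (fun s : ℝ => -(2 * s * B.eig i)) (-(2 * B.eig i)) t := by
    simpa using (((hasDerivAt_id' t).const_mul 2).mul_const (B.eig i)).fun_neg
  refine (h.exp.mul_const (B.fn i x ^ 2)).congr_deriv ?_
  ring

theorem heatEnergy_nonneg [Nonempty V] (x : V) (t : ℝ) : 0 ≤ B.heatEnergy x t := by
  rw [← sum_vol_mul_heatDefect_sq]
  exact G.sum_vol_mul_nonneg fun y => sq_nonneg _

theorem nash_heatEnergy [Nonempty V] (ν : ℝ≥0∞) (hα1 : (1 / ν).toReal < 1) (x : V) {t : ℝ}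
    (ht : 0 ≤ t) :
    -2 * G.dirichletForm (B.heatDefect t x) (B.heatDefect t x) ≤
      -2 * (G.cheegerConst ν ^ 2 * 2 ^ (-(4 * (1 / ν).toReal))) *
        B.heatEnergy x t ^ (1 + 2 * (1 / ν).toReal) := by
  have h := G.nash_inequality ν hα1 (B.sum_vol_mul_heatDefect t x)
  rw [sum_vol_mul_heatDefect_sq] at h
  have hY : (∑ y, G.vol y * |B.heatDefect t x y|) ^ (4 * (1 / ν).toReal) ≤
      2 ^ (4 * (1 / ν).toReal) :=
    Real.rpow_le_rpow (G.sum_vol_mul_nonneg fun y => abs_nonneg _)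
      (B.sum_vol_mul_abs_heatDefect_le ht x)
      (mul_nonneg (by norm_num) ENNReal.toReal_nonneg)
  have h' := h.trans (mul_le_mul_of_nonneg_left hY (G.dirichletForm_self_nonneg _))
  have h2 : (0 : ℝ) < 2 ^ (4 * (1 / ν).toReal) := Real.rpow_pos_of_pos two_pos _
  rw [Real.rpow_neg two_pos.le]
  rw [← div_le_iff₀ h2] at h'
  calc _ ≤ -2 * (G.cheegerConst ν ^ 2 * B.heatEnergy x t ^ (1 + 2 * (1 / ν).toReal) /
        2 ^ (4 * (1 / ν).toReal)) := by linarith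
    _ = _ := by ring

end Eigenbasis

/-! ### Decay, trace and eigenvalue bounds -/

/-- Solutions of `u' ≤ -2 C u ^ (1 + 2 α)` decay like `(4 α C t) ^ (-1 / (2 α))`. -/
theorem le_rpow_of_deriv_le {u u' : ℝ → ℝ} {α C t : ℝ} (hα : 0 < α) (hC : 0 < C) (ht : 0 < t)
    (hu0 : ∀ s, 0 ≤ u s) (hu : ∀ s, HasDerivAt u (u' s) s)
    (hle : ∀ s, 0 ≤ s → u' s ≤ -2 * C * u s ^ (1 + 2 * α)) :
    u t ≤ (4 * α * C * t) ^ (-(1 / (2 * α))) := by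
  rcases (hu0 t).eq_or_lt with h0 | h0
  · rw [← h0]
    positivity
  have hcont : Continuous u := continuous_iff_continuousAt.2 fun s => (hu s).continuousAt
  have hanti : AntitoneOn u (Set.Ici 0) := by
    refine antitoneOn_of_deriv_nonpos (convex_Ici 0) hcont.continuousOn
      (fun s _ => (hu s).differentiableAt.differentiableWithinAt) fun s hs => ?_
    rw [interior_Ici] at hs
    rw [(hu s).deriv]
    refine (hle s (le_of_lt hs)).trans ?_
    have := Real.rpow_nonneg (hu0 s) (1 + 2 * α)
    have := mul_nonneg hC.le this
    linarith
  have hpos : ∀ s ∈ Set.Icc 0 t, 0 < u s := fun s hs =>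
    h0.trans_le (hanti hs.1 ht.le hs.2)
  -- The substitution u^(-2α) linearizes the inequality: its derivative is at least 4αC.
  have hd : ∀ s ∈ Set.Icc 0 t, HasDerivAt (fun s => u s ^ (-(2 * α)) - 4 * α * C * s)
      (u' s * (-(2 * α)) * u s ^ (-(2 * α) - 1) - 4 * α * C) s := fun s hs => by
    have h1 := (hu s).rpow_const (p := -(2 * α)) (Or.inl (hpos s hs).ne')
    have h2 := (hasDerivAt_id' s).const_mul (4 * α * C)
    simpa using h1.fun_sub h2
  have hmono : MonotoneOn (fun s => u s ^ (-(2 * α)) - 4 * α * C * s) (Set.Icc 0 t) := by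
    refine monotoneOn_of_deriv_nonneg (convex_Icc 0 t)
      (fun s hs => (hd s hs).continuousAt.continuousWithinAt)
      (fun s hs => (hd s (interior_subset hs)).differentiableAt.differentiableWithinAt)
      fun s hs => ?_
    have hs := interior_subset hs
    rw [(hd s hs).deriv]
    have hp := Real.rpow_pos_of_pos (hpos s hs) (-(2 * α) - 1)
    have h := mul_le_mul_of_nonneg_right (hle s hs.1) hp.le
    rw [mul_assoc, ← Real.rpow_add (hpos s hs), show 1 + 2 * α + (-(2 * α) - 1) = 0 by ring,
      Real.rpow_zero, mul_one] at h
    have := mul_le_mul_of_nonneg_left h hα.le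
    linarith
  have h := hmono (Set.left_mem_Icc.2 ht.le) (Set.right_mem_Icc.2 ht.le) ht.le
  simp only [mul_zero, sub_zero] at h
  -- The initial term is discarded by positivity, so the bound does not depend on `u 0`.
  have hw := Real.rpow_pos_of_pos (hpos 0 (Set.left_mem_Icc.2 ht.le)) (-(2 * α))
  have h4 : 4 * α * C * t ≤ u t ^ (-(2 * α)) := by linarith
  have h5 := Real.rpow_le_rpow_of_nonpos (by positivity) h4 (z := -(1 / (2 * α)))
    (neg_nonpos.2 (by positivity))
  rw [← Real.rpow_mul h0.le] at h5
  have e : -(2 * α) * -(1 / (2 * α)) = 1 := by field_simp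
  rwa [e, Real.rpow_one] at h5

theorem add_mul_le_sum_map {L : List ℝ} (hL : L.Pairwise (· ≤ ·)) {F : ℝ → ℝ}
    (hF : Antitone F) (hF0 : ∀ s, 0 ≤ F s) {k : ℕ} (hk : 1 ≤ k) (hkL : k < L.length) :
    F L[0] + k * F L[k] ≤ (L.map F).sum := by
  cases L with
  | nil => simp at hkL
  | cons a L =>
    obtain ⟨k, rfl⟩ := Nat.exists_eq_add_of_le' hk
    simp only [List.length_cons, add_lt_add_iff_right] at hkL
    simp only [List.getElem_cons_zero, List.getElem_cons_succ, List.map_cons, List.sum_cons]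
    refine add_le_add le_rfl ?_
    have hL' := (List.pairwise_cons.1 hL).2
    -- Here `L` is the tail and `k` the original index minus one, so `k + 1` entries are at most
    -- `L[k]`.
    have h1 : (((L.take (k + 1)).map F).length) • F L[k] ≤ ((L.take (k + 1)).map F).sum := by
      refine List.card_nsmul_le_sum _ _ fun y hy => ?_
      obtain ⟨z, hz, rfl⟩ := List.mem_map.1 hy
      obtain ⟨j, hj, rfl⟩ := List.mem_iff_getElem.1 hz
      rw [List.getElem_take]
      rw [List.length_take] at hj
      have hjk : j ≤ k := by omega
      refine hF ?_
      rcases hjk.eq_or_lt with h | h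
      · subst h; exact le_rfl
      · exact List.pairwise_iff_getElem.1 hL' j k _ _ h
    have h2 : ((L.take (k + 1)).map F).length = k + 1 := by
      rw [List.length_map, List.length_take]; omega
    rw [h2, nsmul_eq_mul] at h1
    refine h1.trans ?_
    conv_rhs => rw [← List.take_append_drop (k + 1) L]
    rw [List.map_append, List.sum_append]
    refine le_add_of_nonneg_right (List.sum_nonneg fun y hy => ?_)
    obtain ⟨z, -, rfl⟩ := List.mem_map.1 hy
    exact hF0 z

namespace Eigenbasis

variable [Fintype V] [Fintype E] [DecidableEq V]

/-- All roots are real, so the default value `0` in `eigenvalue` is never reached for `k <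
Fintype.card V`. -/
theorem length_sort_roots (B : G.Eigenbasis) : (G.laplacian.charpoly.roots.sort (· ≤ ·)).length =
    Fintype.card V := by
  rw [Multiset.length_sort, B.roots_eq, Multiset.card_map]
  rfl

theorem exists_eig_eq_eigenvalue (B : G.Eigenbasis) {k : ℕ} (hk : k < Fintype.card V) :
    ∃ i, B.eig i = G.eigenvalue k := by
  rw [← B.length_sort_roots] at hk
  have h : G.eigenvalue k ∈ G.laplacian.charpoly.roots := by
    rw [← Multiset.mem_sort (· ≤ ·), eigenvalue, List.getD_eq_getElem _ _ hk]
    exact List.getElem_mem hk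
  rw [B.roots_eq] at h
  simpa using h

theorem eigenvalue_nonneg (B : G.Eigenbasis) {k : ℕ} (hk : k < Fintype.card V) : 0 ≤ G.eigenvalue k := by
  obtain ⟨i, hi⟩ := B.exists_eig_eq_eigenvalue hk
  rw [← hi]
  exact B.eig_nonneg i

theorem eigenvalue_zero (B : G.Eigenbasis) [Nonempty V] : G.eigenvalue 0 = 0 := by
  refine le_antisymm ?_ (B.eigenvalue_nonneg Fintype.card_pos)
  obtain ⟨i, hi⟩ := B.exists_eig_eq_zero
  have h : (0 : ℝ) ∈ G.laplacian.charpoly.roots.sort (· ≤ ·) := by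
    rw [Multiset.mem_sort, B.roots_eq]
    exact Multiset.mem_map.2 ⟨i, Finset.mem_univ i, hi⟩
  obtain ⟨j, hj, h0⟩ := List.mem_iff_getElem.1 h
  have hlen : 0 < (G.laplacian.charpoly.roots.sort (· ≤ ·)).length := by omega
  rw [eigenvalue, List.getD_eq_getElem _ _ hlen]
  conv_rhs => rw [← h0]
  rcases j.eq_zero_or_pos with h | h
  · subst h; exact le_rfl
  · exact List.pairwise_iff_getElem.1 (Multiset.pairwise_sort _ _) 0 j _ _ h

theorem add_mul_le_sum_eig (B : G.Eigenbasis) {F : ℝ → ℝ} (hF : Antitone F) (hF0 : ∀ s, 0 ≤ F s) {k : ℕ}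
    (hk : 1 ≤ k) (hkV : k < Fintype.card V) :
    F 0 + k * F (G.eigenvalue k) ≤ ∑ i, F (B.eig i) := by
  have : Nonempty V := Fintype.card_pos_iff.1 (by omega)
  have h0 := B.eigenvalue_zero
  have hlen := B.length_sort_roots
  have h := add_mul_le_sum_map (L := G.laplacian.charpoly.roots.sort (· ≤ ·))
    (Multiset.pairwise_sort _ _) hF hF0 hk (by omega)
  rw [eigenvalue, List.getD_eq_getElem _ _ (by omega)] at h0 ⊢
  rw [h0] at h
  refine h.trans (le_of_eq ?_)
  rw [← Multiset.sum_coe, ← Multiset.map_coe, Multiset.sort_eq, B.roots_eq, Multiset.map_map]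
  rfl

theorem sum_vol_mul_heatEnergy [Nonempty V] (B : G.Eigenbasis) (t : ℝ) :
    ∑ x, G.vol x * B.heatEnergy x t = ∑ i, Real.exp (-(2 * t * B.eig i)) - 1 := by
  simp only [heatEnergy, mul_sub, Finset.sum_sub_distrib, B.sum_vol_mul_sum_sq,
    ← Finset.sum_mul]
  rw [mul_one_div_cancel (sum_vol_pos (G := G)).ne']

theorem mul_exp_le_sum_heatEnergy [Nonempty V] (B : G.Eigenbasis) {k : ℕ} (hk : 1 ≤ k)
    (hkV : k < Fintype.card V) {t : ℝ} (ht : 0 ≤ t) :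
    k * Real.exp (-(2 * t * G.eigenvalue k)) ≤ ∑ x, G.vol x * B.heatEnergy x t := by
  have h := B.add_mul_le_sum_eig (F := fun s => Real.exp (-(2 * t * s)))
    (fun a b hab => Real.exp_le_exp.2 (neg_le_neg (mul_le_mul_of_nonneg_left hab (by positivity))))
    (fun s => (Real.exp_pos _).le) hk hkV
  rw [sum_vol_mul_heatEnergy]
  simp only [mul_zero, neg_zero, Real.exp_zero] at h
  linarith

theorem rpow_mul_le_eigenvalue [Nonempty V] (B : G.Eigenbasis) (ν : ℝ≥0∞)
    (hα0 : 0 < (1 / ν).toReal) (hα1 : (1 / ν).toReal < 1) {k : ℕ} (hk : 1 ≤ k)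
    (hkV : k < Fintype.card V) :
    (k / ∑ v, G.vol v) ^ (2 * (1 / ν).toReal) *
      (G.cheegerConst ν ^ 2 * 2 ^ (-(4 * (1 / ν).toReal))) / Real.exp 1 ≤ G.eigenvalue k := by
  set α := (1 / ν).toReal
  set C : ℝ := G.cheegerConst ν ^ 2 * 2 ^ (-(4 * α)) with hC
  have hV := sum_vol_pos (G := G)
  set W := ∑ v, G.vol v
  have h2 : (0 : ℝ) < 2 ^ (-(4 * α)) := Real.rpow_pos_of_pos two_pos _
  rcases (G.cheegerConst_nonneg ν).eq_or_lt with hJ | hJ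
  · rw [hC, ← hJ]
    simpa using B.eigenvalue_nonneg hkV
  have hC0 : 0 < C := by positivity
  have hk0 : (0 : ℝ) < k := by exact_mod_cast hk
  have hkW : 0 < (k / W : ℝ) := by positivity
  have hr := Real.rpow_pos_of_pos hkW (2 * α)
  set b := (k / W) ^ (2 * α) * C / Real.exp 1 with hb
  have hb0 : 0 < b := by positivity
  by_contra! hlt
  -- The optimal time: 4αCt (k/W)^(2α) = e, which maximizes log s / s at s = e.
  set t := 1 / (4 * α * b) with ht
  have ht0 : 0 < t := by positivity
  have hdecay : ∀ x, B.heatEnergy x t ≤ (4 * α * C * t) ^ (-(1 / (2 * α))) := fun x =>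
    le_rpow_of_deriv_le hα0 hC0 ht0 (B.heatEnergy_nonneg x) (B.hasDerivAt_heatEnergy x)
      fun s hs => B.nash_heatEnergy ν hα1 x hs
  have hval : (4 * α * C * t) ^ (-(1 / (2 * α))) = k / W * Real.exp (-(1 / (2 * α))) := by
    have e1 : 4 * α * C * t = Real.exp 1 * (k / W) ^ (-(2 * α)) := by
      rw [ht, hb, Real.rpow_neg hkW.le]
      field_simp
    have e2 : -(2 * α) * -(1 / (2 * α)) = 1 := by field_simp
    rw [e1, Real.mul_rpow (Real.exp_pos 1).le (Real.rpow_nonneg hkW.le _), ← Real.rpow_mul hkW.le,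
      e2, Real.rpow_one, ← Real.exp_mul, one_mul, mul_comm]
  have hup : ∑ x, G.vol x * B.heatEnergy x t ≤ W * (k / W * Real.exp (-(1 / (2 * α)))) := by
    rw [Finset.sum_mul]
    exact Finset.sum_le_sum fun x _ =>
      mul_le_mul_of_nonneg_left ((hdecay x).trans hval.le) (G.vol_pos x).le
  have hlow := B.mul_exp_le_sum_heatEnergy hk hkV ht0.le
  have hexp : Real.exp (-(1 / (2 * α))) < Real.exp (-(2 * t * G.eigenvalue k)) := by
    refine Real.exp_lt_exp.2 (neg_lt_neg ?_)
    have e : 2 * t * b = 1 / (2 * α) := by rw [ht]; field_simp; norm_num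
    rw [← e]
    exact mul_lt_mul_of_pos_left hlt (by positivity)
  have := mul_lt_mul_of_pos_left hexp hk0
  rw [← mul_assoc, mul_div_cancel₀ _ hV.ne'] at hup
  linarith

theorem cheeger_inequality [Nonempty V] (B : G.Eigenbasis) (ν : ℝ≥0∞)
    (hα : (1 / ν).toReal = 0) {k : ℕ} (hk : 1 ≤ k) (hkV : k < Fintype.card V) :
    G.cheegerConst ν ^ 2 ≤ G.eigenvalue k := by
  have nash : ∀ f : V → ℝ, ∑ v, G.vol v * f v = 0 →
      G.cheegerConst ν ^ 2 * ∑ v, G.vol v * f v ^ 2 ≤ G.dirichletForm f f := fun f hf => by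
    have h := G.nash_inequality ν (by rw [hα]; exact one_pos) hf
    rw [hα] at h
    simpa using h
  by_contra! hlt
  -- This step function counts at least k + 1 ≥ 2 indices with eigenvalue at most λ_k.
  have hcard := B.add_mul_le_sum_eig (F := fun s => if s ≤ G.eigenvalue k then 1 else 0)
    (fun a b hab => by
      dsimp only
      split_ifs with h1 h2
      exacts [le_rfl, absurd (hab.trans h1) h2, zero_le_one, le_rfl])
    (fun s => by split_ifs <;> norm_num) hk hkV
  simp only [if_pos (B.eigenvalue_nonneg hkV), if_pos le_rfl, mul_one, Finset.sum_boole] at hcard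
  have hk1 : (1 : ℝ) ≤ k := by exact_mod_cast hk
  have htwo : 1 < (Finset.univ.filter fun i => B.eig i ≤ G.eigenvalue k).card := by
    have : (2 : ℝ) ≤ (Finset.univ.filter fun i => B.eig i ≤ G.eigenvalue k).card := by linarith
    exact_mod_cast this
  obtain ⟨i, hi, j, hj, hij⟩ := Finset.one_lt_card.1 htwo
  have hsmall : ∀ l, B.eig l ≤ G.eigenvalue k → B.eig l = 0 ∧ B.integral l ≠ 0 := by
    intro l hl
    have hint : B.integral l ≠ 0 := fun h0 => by
      have h := nash (B.fn l) h0
      have hn := B.orthonormal l l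
      simp only [← sq, if_true] at hn
      rw [hn, B.dirichletForm_fn] at h
      linarith
    exact ⟨(mul_eq_zero.1 (B.eig_mul_integral l)).resolve_right hint, hint⟩
  obtain ⟨hi0, hii⟩ := hsmall i (Finset.mem_filter.1 hi).2
  obtain ⟨hj0, hjj⟩ := hsmall j (Finset.mem_filter.1 hj).2
  -- Both eigenfunctions have eigenvalue 0 and nonzero integral; this combination has mean zero, no
  -- energy and positive norm, against the Poincaré inequality.
  set a : V → ℝ := Pi.single i (B.integral j) - Pi.single j (B.integral i) with ha
  have hf : (fun x => ∑ l, a l * B.fn l x) =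
      fun x => B.integral j * B.fn i x - B.integral i * B.fn j x := by
    funext x
    simp [ha, sub_mul, Finset.sum_sub_distrib, Pi.single_apply]
  have hmean : ∑ x, G.vol x * ∑ l, a l * B.fn l x = 0 := by
    have : ∀ x, ∑ l, a l * B.fn l x = B.integral j * B.fn i x - B.integral i * B.fn j x :=
      fun x => congrFun hf x
    simp only [this, mul_sub, Finset.sum_sub_distrib, mul_left_comm (G.vol _), ← Finset.mul_sum]
    change B.integral j * B.integral i - B.integral i * B.integral j = 0
    ring
  have h := nash _ hmean
  rw [B.dirichletForm_sum] at h
  simp only [sq (Finset.sum _ _), B.sum_vol_mul_sum_mul_sum] at h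
  have hE : ∑ l, B.eig l * a l ^ 2 = 0 := Finset.sum_eq_zero fun l _ => by
    by_cases h1 : l = i
    · rw [h1, hi0, zero_mul]
    by_cases h2 : l = j
    · rw [h2, hj0, zero_mul]
    simp [ha, h1, h2]
  have hpos : 0 < ∑ l, a l * a l :=
    Finset.sum_pos' (fun l _ => mul_self_nonneg _)
      ⟨i, Finset.mem_univ i, by simp [ha, hij, hjj]⟩
  have hJ : 0 < G.cheegerConst ν ^ 2 := (B.eigenvalue_nonneg hkV).trans_lt hlt
  have := mul_pos hJ hpos
  linarith

end Eigenbasis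

end

end ClosedGraph

/-! ### The main theorem -/

theorem mainTheorem8 {V E : Type*} [Fintype V] [Fintype E] (G : ClosedGraph V E)
    (ν : ℝ≥0∞) (hν : 2 < ν) (k : ℕ) (hk : 1 ≤ k) (hkV : k < Fintype.card V) :
    ((k : ℝ) / G.volume Set.univ) ^ (2 / ν).toReal * (2 : ℝ) ^ (-(4 / ν).toReal) *
        (G.isoConst ν * G.rhoSup ^ (-(1 / 2) : ℝ) / 2) ^ 2 / Real.exp 1 ≤ G.eigenvalue k ∧
    (ν ≠ ∞ → 0 < G.isoConst ν →
      ((k : ℝ) / G.volume Set.univ) ^ (2 / ν).toReal * (2 : ℝ) ^ (-(4 / ν).toReal) *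
          (G.isoConst ν * G.rhoSup ^ (-(1 / 2) : ℝ) / 2) ^ 2 / Real.exp 1 =
        ((k : ℝ) / G.volume Set.univ) ^ (2 / ν).toReal * G.nashC₂ ν ^ (-(2 / ν).toReal) *
          (ν.toReal / (2 * Real.exp 1))) := by
  classical
  have : Nonempty V := Fintype.card_pos_iff.1 (by omega)
  have h2 : (2 / ν).toReal = 2 * (1 / ν).toReal := by simp [div_eq_mul_inv]
  have h4 : (4 / ν).toReal = 4 * (1 / ν).toReal := by simp [div_eq_mul_inv]
  have hJ : G.isoConst ν * G.rhoSup ^ (-(1 / 2) : ℝ) / 2 = G.cheegerConst ν := rfl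
  refine ⟨?_, fun hfin _ => ?_⟩
  · obtain ⟨B⟩ := G.nonempty_eigenbasis
    rw [hJ, h2, h4, G.volume_univ]
    rcases eq_or_ne ν ∞ with rfl | hfin
    · have h0 : ((1 : ℝ≥0∞) / ∞).toReal = 0 := by simp
      have h := B.cheeger_inequality ∞ h0 hk hkV
      simp only [h0, mul_zero, neg_zero, Real.rpow_zero, one_mul]
      exact (div_le_self (sq_nonneg _) (Real.one_le_exp zero_le_one)).trans h
    · have hlt : 2 < ν.toReal := by
        simpa using (ENNReal.toReal_lt_toReal (by simp) hfin).2 hν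
      have hα : (1 / ν).toReal = 1 / ν.toReal := by simp
      have h := B.rpow_mul_le_eigenvalue ν (by rw [hα]; positivity)
        (by rw [hα, div_lt_one (by linarith)]; linarith) hk hkV
      refine le_trans (le_of_eq ?_) h
      ring
  · have hlt : 2 < ν.toReal := by
      simpa using (ENNReal.toReal_lt_toReal (by simp) hfin).2 hν
    set n := ν.toReal with hn
    have hn0 : 0 < n := by linarith
    have h2' : (2 / ν).toReal = 2 / n := by simp [ENNReal.toReal_div, hn]
    have h4' : (4 / ν).toReal = 4 / n := by simp [ENNReal.toReal_div, hn]
    have hC1 : G.nashC₁ ν = 2 ^ (-(2 / n)) * G.cheegerConst ν := by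
      rw [ClosedGraph.nashC₁, h2', hJ]
    have hC1n : 0 ≤ G.nashC₁ ν := by
      rw [hC1]
      exact mul_nonneg (Real.rpow_nonneg zero_le_two _) (G.cheegerConst_nonneg ν)
    -- The factor (n/2)⁻¹ cancels against ν/(2e), leaving C₁²/e.
    have hC2 : G.nashC₂ ν ^ (-(2 / n)) = (n / 2)⁻¹ * G.nashC₁ ν ^ 2 := by
      rw [ClosedGraph.nashC₂, ← hn, Real.mul_rpow (by positivity) (Real.rpow_nonneg hC1n _),
        ← Real.rpow_mul (by positivity), ← Real.rpow_mul hC1n,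
        show n / 2 * -(2 / n) = -1 by field_simp, show -n * -(2 / n) = (2 : ℕ) by field_simp; simp,
        Real.rpow_natCast, Real.rpow_neg_one]
    have hpow : ((2 : ℝ) ^ (-(2 / n))) ^ 2 = 2 ^ (-(4 / n)) := by
      rw [← Real.rpow_natCast, ← Real.rpow_mul zero_le_two]
      congr 1
      push_cast
      ring
    rw [hJ, h2', h4', hC2, hC1, mul_pow, hpow]
    have := Real.exp_pos 1
    field_simp
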